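/- Let $M$ be an oriented matroid on $[n]=\{1,\dots,n\}$ with set of signed circuits $\mathscr C$. For $\omega\in\mathbb R^n$ and $C\in\mathscr C$ let $\mathrm{in}_\omega(C)$ be the signed subset of $C$ consisting of the elements of $C$ of largest $\omega$-weight, and let $M_\omega$ be the oriented matroid whose signed circuits are the inclusion-minimal members of $\{\mathrm{in}_\omega(C) : C\in\mathscr C\}$. An oriented matroid is acyclic if it has no all-positive circuit. Put $S^{n-2}=\{\omega\in\mathbb R^n : \sum_i\omega_i=0,\ \sum_i\omega_i^2=1\}$. The positive Bergman complex of $M$ is $$\mathcal B^+(M)=\{\omega\in S^{n-2} : M_\omega \text{ is acyclic}\}.$$ The flag of $\omega$ is the unique chain $\emptyset=F_0\subset F_1\subset\dots\subset F_{k+1}=[n]$ such that $\omega$ is constant on each $F_{i+1}\setminus F_i$ and these constants strictly increase with $i$. The fine subdivision of $\mathcal B^+(M)$ is its partition into the classes of vectors having the same flag. If $M$ is acyclic, a positive flat of $M$ is a flat that is the zero set of a covector with entries in $\{+,0\}$, or the set $[n]$; the Las Vergnas face lattice $\mathcal F_{\ell v}(M)$ is the set of positive flats ordered by containment, with least element $\hat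 0$ and greatest element $\hat 1$. If $M$ is acyclic, then the fine subdivision of $\mathcal B^+(M)$ is a geometric realization (by spherical simplices) of the order complex $\Delta(\mathcal F_{\ell v}(M)-\{\hat 0,\hat 1\})$. That is, the vertices $F$ of $\Delta=\Delta(\mathcal F_{\ell v}(M)-\{\hat 0,\hat 1\})$ can be placed at points $p_F\in\mathbb R^n$ such that $x\mapsto \sum_F x_F p_F\big/\big\|\sum_F x_F p_F\big\|$ (with $x$ in barycentric coordinates) is a well-defined homeomorphism from $|\Delta|$ onto $\mathcal B^+(M)$, under which the images of the relatively open simplices of $\Delta$ are exactly the cells of the fine subdivision. If $M$ is not acyclic (in which case $\mathcal F_{\ell v}(M)$ is not defined), then $\mathcal B^+(M)$ is empty. -/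

import Mathlib

/-! ### Signed sets

A signed subset `X` of `α` is a map `α → SignType`: `X⁺ = {e | X e = 1}`, `X⁻ = {e | X e = -1}`. -/

namespace SignedSet

variable {α : Type*}

/-- The underlying set `X⁺ ∪ X⁻` of a signed set. -/
def support (X : α → SignType) : Set α := {e | X e ≠ 0}

/-- The zero set of a sign vector. -/
def zeroSet (X : α → SignType) : Set α := {e | X e = 0}

/-- Inclusion of signed sets: `X⁺ ⊆ Y⁺` and `X⁻ ⊆ Y⁻`. -/
def IsSubset (X Y : α → SignType) : Prop :=
  ∀ e, (X e = 1 → Y e = 1) ∧ (X e = -1 → Y e = -1)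

/-- All entries are `+` or `0`. -/
def IsPositive (X : α → SignType) : Prop := ∀ e, X e = 1 ∨ X e = 0

/-- Orthogonality of signed sets: either the supports are disjoint, or there are an element on which
the signs agree and an element on which they are opposite. -/
def Orthogonal (X Y : α → SignType) : Prop :=
  (∀ e, X e * Y e = 0) ∨ ((∃ e, X e * Y e = 1) ∧ (∃ f, X f * Y f = -1))

open Classical in
/-- The composition `X ∘ Y`: it equals `X` on the support of `X`, and `Y` elsewhere. -/
noncomputable def comp (X Y : α → SignType) : α → SignType :=
  fun e => if X e ≠ 0 then X e else Y e

open Classical in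
/-- `in_ω(X)`: the restriction of the signed set `X` to its elements of largest `ω`-weight. -/
noncomputable def initial (ω : α → ℝ) (X : α → SignType) : α → SignType :=
  fun e => if ∀ f ∈ support X, ω f ≤ ω e then X e else 0

/-- A collection of signed circuits is acyclic if it contains no all-positive circuit. -/
def IsAcyclic (𝒞 : Set (α → SignType)) : Prop := ∀ C ∈ 𝒞, ¬ IsPositive C

end SignedSet

/-! ### Oriented matroids -/

/-- An oriented matroid on the ground set `α`, given by its signed circuits. -/
structure OrientedMatroid (α : Type*) where
  /-- The collection of signed circuits. -/
  circuits : Set (α → SignType)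
  /-- The empty signed set is not a circuit. -/
  zero_notMem : (0 : α → SignType) ∉ circuits
  /-- The opposite of a circuit is a circuit. -/
  neg_mem : ∀ X ∈ circuits, -X ∈ circuits
  /-- Incomparability of the supports. -/
  eq_or_eq_neg : ∀ X ∈ circuits, ∀ Y ∈ circuits,
    SignedSet.support X ⊆ SignedSet.support Y → X = Y ∨ X = -Y
  /-- Weak circuit elimination. -/
  elimination : ∀ X₀ ∈ circuits, ∀ X₁ ∈ circuits, X₁ ≠ -X₀ → ∀ e, X₀ e = 1 → X₁ e = -1 →
    ∃ X ∈ circuits, X e = 0 ∧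
      ∀ f, (X f = 1 → X₀ f = 1 ∨ X₁ f = 1) ∧ (X f = -1 → X₀ f = -1 ∨ X₁ f = -1)

namespace OrientedMatroid

open SignedSet

variable {α : Type*} (M : OrientedMatroid α)

/-- The signed circuits of `M_ω`: the inclusion-minimal members of `{in_ω(C) | C a circuit}`. -/
def initialCircuits (ω : α → ℝ) : Set (α → SignType) :=
  {Y | Y ∈ initial ω '' M.circuits ∧ ∀ Z ∈ initial ω '' M.circuits, IsSubset Z Y → Z = Y}

/-- `M` is acyclic: it has no all-positive circuit. -/
def IsAcyclic : Prop := SignedSet.IsAcyclic M.circuits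

/-- Signed sets that are orthogonal to every circuit. -/
def orthogonalSet : Set (α → SignType) := {Y | ∀ C ∈ M.circuits, Orthogonal C Y}

/-- The signed cocircuits, that is, the signed circuits of the dual oriented matroid: the nonzero
signed sets of minimal support that are orthogonal to every circuit. -/
def cocircuits : Set (α → SignType) :=
  {Y | Y ∈ M.orthogonalSet ∧ Y ≠ 0 ∧
    ∀ Z ∈ M.orthogonalSet, Z ≠ 0 → support Z ⊆ support Y → support Z = support Y}

/-- The covectors are the compositions of finitely many cocircuits (the empty composition is the
zero covector). -/
inductive IsCovector : (α → SignType) → Prop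
  | zero : IsCovector 0
  | comp (X Y : α → SignType) : X ∈ M.cocircuits → IsCovector Y → IsCovector (SignedSet.comp X Y)

/-- Flats of the underlying matroid: no circuit has exactly one element outside of `F`. -/
def IsFlat (F : Set α) : Prop := ∀ C ∈ M.circuits, ¬ ∃! e, e ∈ support C ∧ e ∉ F

/-- A positive flat is a flat that is the zero set of a positive covector; the whole ground set is
also considered to be a positive flat. -/
def IsPositiveFlat (F : Set α) : Prop :=
  M.IsFlat F ∧ (F = Set.univ ∨ ∃ Y, M.IsCovector Y ∧ IsPositive Y ∧ zeroSet Y = F)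

/-- The Las Vergnas face lattice: the positive flats, ordered by containment. It is the Las Vergnas
face lattice only when `M` is acyclic. -/
abbrev LasVergnasLattice : Type _ := {F : Set α // M.IsPositiveFlat F}

end OrientedMatroid

/-! ### The positive Bergman complex -/

/-- The flag `∅ = F₀ ⊂ F₁ ⊂ ⋯ ⊂ F_{k+1}` of a weight vector on a finite set: its members are the
sublevel sets of `ω`. Thus `ω` is constant on each `F_{i+1} \ F_i`, and these constants increase
with `i`. -/
def weightFlag {α : Type*} (ω : α → ℝ) : Set (Set α) :=
  insert ∅ {F | ∃ t : ℝ, F = {e | ω e ≤ t}}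

/-- The sphere `S^{n-2} = {ω ∈ ℝⁿ | ∑ ωᵢ = 0, ∑ ωᵢ² = 1}`. -/
def bergmanSphere (n : ℕ) : Set (EuclideanSpace ℝ (Fin n)) :=
  {ω | ∑ i, ω i = 0 ∧ ∑ i, ω i ^ 2 = 1}

namespace OrientedMatroid

/-- The positive Bergman complex `{ω ∈ S^{n-2} | M_ω is acyclic}`. -/
def positiveBergmanComplex {n : ℕ} (M : OrientedMatroid (Fin n)) :
    Set (EuclideanSpace ℝ (Fin n)) :=
  {ω | ω ∈ bergmanSphere n ∧ SignedSet.IsAcyclic (M.initialCircuits (fun i => ω i))}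

/-- The fine subdivision of the positive Bergman complex, as the collection of its (relatively open,
nonempty) cells: two vectors lie in the same cell if and only if they have the same flag. -/
def fineSubdivision {n : ℕ} (M : OrientedMatroid (Fin n)) :
    Set (Set (EuclideanSpace ℝ (Fin n))) :=
  {cell | ∃ u ∈ M.positiveBergmanComplex,
    cell = {v ∈ M.positiveBergmanComplex | weightFlag (fun i => v i) = weightFlag (fun i => u i)}}

end OrientedMatroid

/-! ### Order complexes and geometric realizations -/

/-- The proper part `P - {0̂, 1̂}` of a poset. -/
abbrev ProperPart (P : Type*) [LE P] : Type _ := {x : P // ¬ IsBot x ∧ ¬ IsTop x}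

/-- The order complex of a poset: the faces are the finite nonempty chains. -/
def orderComplex (P : Type*) [PartialOrder P] : AbstractSimplicialComplex P where
  faces := {s | s.Nonempty ∧ IsChain (· ≤ ·) (s : Set P)}
  isRelLowerSet_faces := fun _ hs =>
    ⟨hs.1, fun _ hts ht => ⟨ht, hs.2.mono (Finset.coe_subset.mpr hts)⟩⟩
  singleton_mem := fun v => ⟨Finset.singleton_nonempty v, by simp⟩

namespace AbstractSimplicialComplex

variable {V : Type*} [Fintype V] (K : AbstractSimplicialComplex V)

/-- The standard realization `|K|` of a finite simplicial complex in barycentric coordinates, with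
the subspace topology of `V → ℝ`. -/
def realization : Set (V → ℝ) :=
  {x | x ∈ stdSimplex ℝ V ∧ ∃ s ∈ K.faces, ∀ v, x v ≠ 0 → v ∈ s}

/-- The relatively open simplex of `|K|` that belongs to a set `s` of vertices. -/
def openSimplex (s : Finset V) : Set K.realization := {x | ∀ v, x.1 v ≠ 0 ↔ v ∈ s}

/-- A subset `X` of the unit sphere of `E`, subdivided into the relatively open cells `cells`, is a
geometric realization of `K` by spherical simplices: the vertices of `K` can be placed at points
`p v` such that the map which sends barycentric coordinates `x` to the radial projection of
`∑ v, x v • p v` to the sphere is a homeomorphism `|K| → X`, and the cells are exactly the images of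
the relatively open simplices of the faces of `K`. -/
def IsSphericalRealization {E : Type*} [NormedAddCommGroup E] [NormedSpace ℝ E]
    (X : Set E) (cells : Set (Set E)) : Prop :=
  X ⊆ Metric.sphere 0 1 ∧
  ∃ (p : V → E) (h : K.realization ≃ₜ X),
    (∀ x : K.realization, (h x : E) = ‖∑ v, x.1 v • p v‖⁻¹ • ∑ v, x.1 v • p v) ∧
    cells = {cell | ∃ s ∈ K.faces, cell = (fun x => (h x : E)) '' K.openSimplex s}

end AbstractSimplicialComplex

/-- There are finitely many subsets of `Fin n`, hence finitely many elements in the proper part. -/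
noncomputable instance OrientedMatroid.fintypeProperPart {n : ℕ} (M : OrientedMatroid (Fin n)) :
    Fintype (ProperPart M.LasVergnasLattice) :=
  Fintype.ofFinite _

/-! For acyclic `M`, the key fact is that `M_ω` is acyclic exactly when every member of the flag of
`ω` is a positive flat (`isAcyclic_initialCircuits_iff_isPositiveFlat`). If a circuit meets the
complement of a sublevel set `F` and has no negative entry there, its initial form is positive.
Conversely, if `in_ω(C)` is positive of weight `t`, then `C` is nonnegative off `{ω < t}` and meets
its complement, so it cannot be orthogonal to a positive covector with zero set `{ω < t}`. What
remains is a Farkas-type statement: if no circuit meeting `Fᶜ` is nonnegative there, `F` is the zero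
set of a positive covector (`exists_isCovector_zeroSet_eq`). It follows from the four-painting lemma
`exists_circuit_or_cocircuit`. Since cocircuits are defined only by orthogonality and minimal
support, their existence is derived from weak elimination: contract a hyperplane and read off the
signs from the two-element circuits in rank one. That contraction again satisfies weak elimination
rests on the conformal circuits of `exists_mem_contractCircuits`. The geometry is then elementary.
Up to a constant, a weight vector is a unique nonnegative combination of the indicators of
complements of the proper nonempty members of its flag, the coefficients being its jumps
(`exists_profile_eq`, `eq_of_profile_affine`). Placing a flat at the centered indicator of its
complement gives a continuous bijection from a compact space to a Hausdorff space, and the support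
of the coefficients determines the flag and conversely. -/

namespace OrientedMatroid

open SignedSet

/-! ### Contraction of oriented matroids from weak elimination. -/

section Contraction

variable {α : Type*} {M : OrientedMatroid α}

theorem ne_zero_of_mem_circuits {C : α → SignType} (hC : C ∈ M.circuits) : C ≠ 0 :=
  fun h => M.zero_notMem (h ▸ hC)

theorem exists_ne_zero_of_mem_circuits {C : α → SignType} (hC : C ∈ M.circuits) :
    ∃ e, C e ≠ 0 := by
  by_contra! h
  exact ne_zero_of_mem_circuits hC (funext h)

theorem eq_zero_of_support_subset {C D : α → SignType} (hC : C ∈ M.circuits)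
    (hD : D ∈ M.circuits) (h : ∀ x, D x = 0 → C x = 0) (x : α) (hx : C x = 0) : D x = 0 := by
  rcases M.eq_or_eq_neg C hC D hD (fun y hy hy' => hy (h y hy')) with rfl | rfl
  · exact hx
  · simpa using hx

/-- A circuit that is contained in `Z ∪ {g}` and does not contain `Z` passes through `g`. -/
theorem ne_zero_of_support_subset_insert {Z W : α → SignType} {g : α} (hZ : Z ∈ M.circuits)
    (hW : W ∈ M.circuits) (hWZ : ∀ x, x ≠ g → Z x = 0 → W x = 0) {y : α} (hy : Z y ≠ 0)
    (hWy : W y = 0) : W g ≠ 0 := by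
  intro hWg
  refine hy (eq_zero_of_support_subset hW hZ (fun x hx => ?_) y hWy)
  by_cases hxg : x = g
  · rw [hxg, hWg]
  · exact hWZ x hxg hx

/-- Weak elimination at an element where two circuits have opposite signs. -/
theorem exists_elimination {X Y : α → SignType} (hX : X ∈ M.circuits) (hY : Y ∈ M.circuits)
    (hne : Y ≠ -X) {e : α} (he : X e ≠ 0) (h : Y e = -X e) :
    ∃ Z ∈ M.circuits, Z e = 0 ∧ ∀ x, Z x = 0 ∨ Z x = X x ∨ Z x = Y x := by
  have key : ∀ X ∈ M.circuits, ∀ Y ∈ M.circuits, Y ≠ -X → X e = 1 → Y e = -1 →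
      ∃ Z ∈ M.circuits, Z e = 0 ∧ ∀ x, Z x = 0 ∨ Z x = X x ∨ Z x = Y x := by
    intro X hX Y hY hne h1 h2
    obtain ⟨Z, hZ, hZe, hZs⟩ := M.elimination X hX Y hY hne e h1 h2
    refine ⟨Z, hZ, hZe, fun x => ?_⟩
    have := hZs x
    revert this
    generalize Z x = a
    generalize X x = b
    generalize Y x = c
    revert a b c
    decide
  rcases SignType.trichotomy (X e) with h1 | h1 | h1
  · obtain ⟨Z, hZ, hZe, hZs⟩ := key Y hY X hX
      (fun h' => hne (by rw [h', neg_neg])) (by rw [h, h1]; rfl) h1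
    exact ⟨Z, hZ, hZe, fun x => by have := hZs x; tauto⟩
  · exact absurd h1 he
  · exact key X hX Y hY hne h1 (by rw [h, h1])

/-- The elements other than `g` on which the signs of `W` and `Z` are opposite. -/
def conflicts (g : α) (Z W : α → SignType) : Set α := {x | x ≠ g ∧ W x ≠ 0 ∧ W x = -Z x}

/-- If `Z` stops being a circuit on contracting `g`, then each of its elements lies in a circuit
through `g` that conforms to `Z` outside of `g`. -/
theorem exists_conformal_of_ssubset [Finite α] {Z D : α → SignType} {f g : α}
    (hZ : Z ∈ M.circuits) (hD : D ∈ M.circuits) (hf : Z f ≠ 0) (hg : Z g = 0)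
    (hDZ : ∀ x, x ≠ g → Z x = 0 → D x = 0) (hDf : D f = 0) (hD0 : ∃ h, h ≠ g ∧ D h ≠ 0) :
    ∃ W ∈ M.circuits, W g ≠ 0 ∧ W f = Z f ∧ ∀ x, x ≠ g → W x = 0 ∨ W x = Z x := by
  obtain ⟨h, hhg, hDh⟩ := hD0
  have hZh : Z h ≠ 0 := fun h0 => hDh (hDZ h hhg h0)
  have through := fun W hW hWZ y hy hWy => ne_zero_of_support_subset_insert hZ (W := W) (g := g)
    hW hWZ (y := y) hy hWy
  -- This sign at `h` later guarantees `D ≠ -W`, so that `g` can be eliminated between `W` and `D`.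
  wlog hsign : D h = Z h generalizing D with H
  · refine H (D := -D) (M.neg_mem D hD) (fun x hx hx' => by simp [hDZ x hx hx']) (by simp [hDf])
      (by simpa using hDh) ?_
    revert hsign hDh hZh
    simp only [Pi.neg_apply]
    generalize D h = a
    generalize Z h = b
    revert a b
    decide
  have hDg : D g ≠ 0 := through D hD hDZ f hf hDf
  let S : Set (α → SignType) := {W | W ∈ M.circuits ∧ W g = -D g ∧
    (∀ x, x ≠ g → Z x = 0 → W x = 0) ∧ h ∉ conflicts g Z W}
  have hS : S.Nonempty := by
    obtain ⟨W, hW, hWh, hWs⟩ := exists_elimination hZ (M.neg_mem D hD)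
      (fun he => hDg (by have := congrFun he g; simpa [hg] using this)) hZh (by simp [hsign])
    have hWZ : ∀ x, x ≠ g → Z x = 0 → W x = 0 := by
      intro x hx hx0
      rcases hWs x with h1 | h1 | h1
      · exact h1
      · rw [h1, hx0]
      · rw [h1, Pi.neg_apply, hDZ x hx hx0]; rfl
    have hWg := through W hW hWZ h hZh hWh
    refine ⟨W, hW, ?_, hWZ, fun hc => hc.2.1 hWh⟩
    rcases hWs g with h1 | h1 | h1
    · exact absurd h1 hWg
    · exact absurd (h1.trans hg) hWg
    · exact h1
  obtain ⟨W, ⟨hW, hWg, hWZ, hWh⟩, hmin⟩ := Set.exists_min_image S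
    (fun W => (conflicts g Z W).ncard) (Set.toFinite S) hS
  have hWg0 : W g ≠ 0 := by rw [hWg]; simpa using hDg
  -- Eliminating a conflict `y` between `W` and `Z` keeps the sign at `g` and creates no new
  -- conflict, contradicting minimality.
  have hconf : conflicts g Z W = ∅ := by
    by_contra hne
    obtain ⟨y, hy⟩ := Set.nonempty_iff_ne_empty.2 hne
    obtain ⟨hyg, hy0, hyZ⟩ := hy
    obtain ⟨V, hV, hVy, hVs⟩ := exists_elimination hW hZ
      (fun he => hWg0 (by have := congrFun he g; simpa [hg] using this.symm)) hy0
      (by rw [hyZ, neg_neg])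
    have hVZ : ∀ x, x ≠ g → Z x = 0 → V x = 0 := by
      intro x hx hx0
      rcases hVs x with h1 | h1 | h1
      · exact h1
      · rw [h1, hWZ x hx hx0]
      · rw [h1, hx0]
    have hVg := through V hV hVZ y (fun h0 => hy0 (by rw [hyZ, h0]; rfl)) hVy
    have hVg' : V g = W g := by
      rcases hVs g with h1 | h1 | h1
      · exact absurd h1 hVg
      · exact h1
      · exact absurd (h1.trans hg) hVg
    have hsub : conflicts g Z V ⊆ conflicts g Z W \ {y} := by
      rintro x ⟨hxg, hx0, hxZ⟩
      refine ⟨⟨hxg, ?_⟩, fun hxy => hx0 (by rw [hxy]; exact hVy)⟩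
      rcases hVs x with h1 | h1 | h1
      · exact absurd h1 hx0
      · exact ⟨h1 ▸ hx0, h1 ▸ hxZ⟩
      · exfalso
        rw [h1] at hxZ hx0
        revert hxZ hx0
        generalize Z x = a
        revert a
        decide
    have h1 := hmin V ⟨hV, hVg'.trans hWg, hVZ, fun hc => hWh (hsub hc).1⟩
    have h2 : (conflicts g Z V).ncard < (conflicts g Z W).ncard :=
      Set.ncard_lt_ncard ⟨fun x hx => (hsub hx).1, fun h' => (hsub (h' ⟨hyg, hy0, hyZ⟩)).2 rfl⟩
        (Set.toFinite _)
    exact absurd h1 (not_le.2 h2)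
  -- Otherwise eliminating `g` between `W` and `D` gives a circuit inside `Z` that misses both `f`
  -- and `g`.
  have hWf : W f ≠ 0 := by
    intro hWf
    have hne : D ≠ -W := by
      rintro rfl
      exact hWh ⟨hhg, by simpa using hDh, by rw [← hsign]; simp⟩
    obtain ⟨V, hV, hVg, hVs⟩ := exists_elimination hW hD hne hWg0 (by rw [hWg, neg_neg])
    refine through V hV (fun x hx hx0 => ?_) f hf ?_ hVg
    · rcases hVs x with h1 | h1 | h1
      · exact h1
      · rw [h1, hWZ x hx hx0]
      · rw [h1, hDZ x hx hx0]
    · rcases hVs f with h1 | h1 | h1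
      · exact h1
      · rw [h1, hWf]
      · rw [h1, hDf]
  have hall : ∀ x, x ≠ g → W x = 0 ∨ W x = Z x := by
    intro x hx
    have h1 : ¬ (W x ≠ 0 ∧ W x = -Z x) := fun h' =>
      (hconf ▸ (⟨hx, h'⟩ : x ∈ conflicts g Z W) : x ∈ (∅ : Set α))
    have h2 := hWZ x hx
    revert h1 h2
    generalize W x = a
    generalize Z x = b
    revert a b
    decide
  exact ⟨W, hW, hWg0, (hall f (fun h' => hf (h' ▸ hg))).resolve_left hWf, hall⟩

open Classical in
/-- The signed sets `C \ g`, for circuits `C`, of minimal nonempty support. -/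
def contractCircuits (M : OrientedMatroid α) (g : α) : Set (α → SignType) :=
  {X | X ≠ 0 ∧ (∃ C ∈ M.circuits, X = Function.update C g 0) ∧
    ∀ D ∈ M.circuits, Function.update D g 0 ≠ 0 →
      (∀ x, X x = 0 → x ≠ g → D x = 0) → ∀ x, x ≠ g → D x = 0 → X x = 0}

open Classical in
theorem update_ne_zero_iff {D : α → SignType} {g : α} :
    Function.update D g 0 ≠ 0 ↔ ∃ h, h ≠ g ∧ D h ≠ 0 := by
  rw [Function.ne_iff]
  refine exists_congr fun h => ?_
  by_cases hg : h = g
  · subst hg; simp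
  · simp [hg]

open Classical in
-- A circuit contained in `C` up to `g` lies inside `C`, because `g ∈ C`; incomparability then gives
-- minimality.
theorem update_mem_contractCircuits {C : α → SignType} {g : α} (hC : C ∈ M.circuits)
    (hg : C g ≠ 0) (h0 : ∃ h, h ≠ g ∧ C h ≠ 0) :
    Function.update C g 0 ∈ M.contractCircuits g := by
  refine ⟨update_ne_zero_iff.2 h0, ⟨C, hC, rfl⟩, fun D hD _ hDC x hx hDx => ?_⟩
  rw [Function.update_of_ne hx]
  refine eq_zero_of_support_subset hD hC (fun y hy => ?_) x hDx
  have hyg : y ≠ g := fun h => hg (h ▸ hy)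
  exact hDC y (by rwa [Function.update_of_ne hyg]) hyg

/-- Each element of `Z \ g` lies in a circuit of the contraction that conforms to `Z`. -/
theorem exists_mem_contractCircuits [Finite α] {Z : α → SignType} {f g : α}
    (hZ : Z ∈ M.circuits) (hfg : f ≠ g) (hf : Z f ≠ 0) :
    ∃ X ∈ M.contractCircuits g, X f = Z f ∧ ∀ x, X x = 0 ∨ X x = Z x := by
  classical
  by_cases hmem : Function.update Z g 0 ∈ M.contractCircuits g
  · refine ⟨_, hmem, Function.update_of_ne hfg .., fun x => ?_⟩
    by_cases hx : x = g
    · subst hx; simp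
    · simp [hx]
  have hZg : Z g = 0 := by
    by_contra h
    exact hmem (update_mem_contractCircuits hZ h ⟨f, hfg, hf⟩)
  have hupd : Function.update Z g 0 = Z := by rw [← hZg, Function.update_eq_self]
  rw [hupd] at hmem
  have : ∃ D ∈ M.circuits, (∃ h, h ≠ g ∧ D h ≠ 0) ∧ (∀ x, x ≠ g → Z x = 0 → D x = 0) ∧
      ∃ y, y ≠ g ∧ D y = 0 ∧ Z y ≠ 0 := by
    by_contra! hcon
    refine hmem ⟨ne_zero_of_mem_circuits hZ, ⟨Z, hZ, hupd.symm⟩, fun D hD h0 hs x hx hDx => ?_⟩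
    exact hcon D hD (update_ne_zero_iff.1 h0) (fun x hx h => hs x h hx) x hx hDx
  obtain ⟨D, hD, hD0, hDZ, y, hyg, hDy, hZy⟩ := this
  have through := fun W hW hWZ y hy hWy => ne_zero_of_support_subset_insert hZ (W := W) (g := g)
    hW hWZ (y := y) hy hWy
  have hDg := through D hD hDZ y hZy hDy
  -- The smaller circuit may be assumed to miss `f`: if not, eliminate `f` between `Z` and whichever
  -- of `±D` is opposite to `Z` at `f`.
  have : ∃ D ∈ M.circuits, (∃ h, h ≠ g ∧ D h ≠ 0) ∧ (∀ x, x ≠ g → Z x = 0 → D x = 0) ∧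
      D f = 0 := by
    by_cases hDf : D f = 0
    · exact ⟨D, hD, hD0, hDZ, hDf⟩
    have hE : ∃ E ∈ M.circuits, (∃ h, h ≠ g ∧ E h ≠ 0) ∧ (∀ x, x ≠ g → Z x = 0 → E x = 0) ∧
        E g ≠ 0 ∧ E f = -Z f ∧ ∀ x, D x = 0 ↔ E x = 0 := by
      by_cases hs : D f = -Z f
      · exact ⟨D, hD, hD0, hDZ, hDg, hs, fun x => Iff.rfl⟩
      · refine ⟨-D, M.neg_mem D hD, by simpa using hD0, by simpa using hDZ, by simpa using hDg,
          ?_, by simp⟩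
        revert hs hDf hf
        simp only [Pi.neg_apply]
        generalize D f = a
        generalize Z f = b
        revert a b
        decide
    obtain ⟨E, hE, hE0, hEZ, hEg, hEf, hDE⟩ := hE
    obtain ⟨V, hV, hVf, hVs⟩ := exists_elimination hZ hE
      (fun he => hEg (by rw [he]; simp [hZg])) hf hEf
    have hVZ : ∀ x, x ≠ g → Z x = 0 → V x = 0 := by
      intro x hx hx0
      rcases hVs x with h1 | h1 | h1
      · exact h1
      · rw [h1, hx0]
      · rw [h1, hEZ x hx hx0]
    refine ⟨V, hV, ?_, hVZ, hVf⟩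
    by_contra! hcon
    obtain ⟨h, hhg, hEh⟩ := hE0
    refine hEh (eq_zero_of_support_subset hV hE (fun x hx => ?_) h (hcon h hhg))
    exact hcon x (fun h => hEg (h ▸ hx))
  obtain ⟨D, hD, hD0, hDZ, hDf⟩ := this
  obtain ⟨W, hW, hWg, hWf, hWs⟩ := exists_conformal_of_ssubset hZ hD hf hZg hDZ hDf hD0
  refine ⟨Function.update W g 0, update_mem_contractCircuits hW hWg ⟨f, hfg, by rwa [hWf]⟩,
    by rw [Function.update_of_ne hfg, hWf], fun x => ?_⟩
  by_cases hx : x = g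
  · subst hx; simp
  · rw [Function.update_of_ne hx]; exact hWs x hx

/-- The contraction of an element `g`, as an oriented matroid on the same ground set in which no
circuit contains `g`. -/
def contract [Finite α] (M : OrientedMatroid α) (g : α) : OrientedMatroid α where
  circuits := M.contractCircuits g
  zero_notMem := fun h => h.1 rfl
  neg_mem := by
    classical
    rintro X ⟨hX0, ⟨C, hC, rfl⟩, hmin⟩
    refine ⟨fun h => hX0 (by rw [← neg_neg (Function.update C g 0), h]; rfl), ⟨-C, M.neg_mem C hC, ?_⟩, fun D hD h0 hs x hx hDx => ?_⟩
    · ext x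
      by_cases hx : x = g
      · subst hx; simp
      · simp [hx]
    · have := hmin D hD h0 (fun x hx => hs x (by rw [Pi.neg_apply, hx]; rfl)) x hx hDx
      rw [Pi.neg_apply, this]; rfl
  eq_or_eq_neg := by
    classical
    rintro X ⟨hX0, ⟨C, hC, rfl⟩, -⟩ Y ⟨-, ⟨D, hD, rfl⟩, hmin⟩ hXY
    have h1 : ∀ x, x ≠ g → D x = 0 → C x = 0 := by
      intro x hx hDx
      by_contra hCx
      have := @hXY x (by simpa [support, hx] using hCx)
      simp [support, hx, hDx] at this
    have h2 : ∀ x, x ≠ g → C x = 0 → D x = 0 := by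
      intro x hx hCx
      have := hmin C hC hX0 (fun y hy hyg => h1 y hyg (by simpa [hyg] using hy)) x hx hCx
      simpa [hx] using this
    have h3 : C = D ∨ C = -D := by
      -- The supports agree off `g`, so one contains the other.
      by_cases hg : D g = 0 → C g = 0
      · refine M.eq_or_eq_neg C hC D hD fun x hx hDx => hx ?_
        by_cases hxg : x = g
        · rw [hxg] at hDx ⊢; exact hg hDx
        · exact h1 x hxg hDx
      · have : D = C ∨ D = -C := by
          refine M.eq_or_eq_neg D hD C hC fun x hx hCx => hx ?_
          by_cases hxg : x = g
          · rw [hxg]; tauto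
          · exact h2 x hxg hCx
        rcases this with rfl | rfl
        · exact Or.inl rfl
        · exact Or.inr (neg_neg _).symm
    rcases h3 with rfl | rfl
    · exact Or.inl rfl
    · refine Or.inr (funext fun x => ?_)
      by_cases hx : x = g
      · subst hx; simp
      · simp [hx]
  elimination := by
    classical
    rintro X ⟨hX0, ⟨C, hC, rfl⟩, -⟩ Y ⟨hY0, ⟨D, hD, rfl⟩, -⟩ hne e hXe hYe
    have heg : e ≠ g := by rintro rfl; simp at hXe
    rw [Function.update_of_ne heg] at hXe hYe
    have hne' : D ≠ -C := by
      rintro rfl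
      refine hne (funext fun x => ?_)
      by_cases hx : x = g
      · subst hx; simp
      · simp [hx]
    obtain ⟨Z, hZ, hZe, hZs⟩ := M.elimination C hC D hD hne' e hXe hYe
    -- If `Z` were supported on `g` alone, `g` would be a loop, absent from `C` and `D`, hence from
    -- `Z`.
    have hZ0 : ∃ h, h ≠ g ∧ Z h ≠ 0 := by
      by_contra! hcon
      have hZg : Z g ≠ 0 := by
        obtain ⟨y, hy⟩ := exists_ne_zero_of_mem_circuits hZ
        by_cases hyg : y = g
        · rwa [hyg] at hy
        · exact absurd (hcon y hyg) hy
      have hloop : ∀ A ∈ M.circuits, Function.update A g 0 ≠ 0 → A g = 0 := by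
        intro A hA hA0
        by_contra hAg
        obtain ⟨h, hhg, hAh⟩ := update_ne_zero_iff.1 hA0
        exact hAh (eq_zero_of_support_subset hZ hA
          (fun x hx => hcon x (fun h => hAg (h ▸ hx))) h (hcon h hhg))
      have := hZs g
      rw [hloop C hC hX0, hloop D hD hY0] at this
      revert this hZg
      generalize Z g = a
      revert a
      decide
    obtain ⟨h, hhg, hZh⟩ := hZ0
    obtain ⟨W, hW, -, hWs⟩ := exists_mem_contractCircuits hZ hhg hZh
    refine ⟨W, hW, ?_, fun x => ?_⟩
    · rcases hWs e with h1 | h1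
      · exact h1
      · rw [h1, hZe]
    · by_cases hx : x = g
      · obtain ⟨-, ⟨A, -, rfl⟩, -⟩ := hW
        subst hx
        simp
      · rw [Function.update_of_ne hx, Function.update_of_ne hx]
        rcases hWs x with h1 | h1
        · rw [h1]; simp
        · rw [h1]; exact hZs x

/-- The contraction of a finite set `T`, characterized by its relation to the circuits of `M`. -/
theorem exists_contraction [Finite α] (M : OrientedMatroid α) (T : Finset α) :
    ∃ N : OrientedMatroid α,
      (∀ X ∈ N.circuits, ∃ C ∈ M.circuits, (∀ x ∈ T, X x = 0) ∧ ∀ x ∉ T, X x = C x) ∧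
      ∀ C ∈ M.circuits, ∀ f ∉ T, C f ≠ 0 →
        ∃ X ∈ N.circuits, X f = C f ∧ ∀ x, X x = 0 ∨ X x = C x := by
  classical
  induction T using Finset.induction_on with
  | empty => exact ⟨M, fun X hX => ⟨X, hX, by simp⟩, fun C hC f _ _ => ⟨C, hC, by simp⟩⟩
  | insert g T _ ih =>
    obtain ⟨N, h1, h2⟩ := ih
    refine ⟨N.contract g, ?_, fun C hC f hf hCf => ?_⟩
    · rintro _ ⟨-, ⟨Y, hY, rfl⟩, -⟩
      obtain ⟨C, hC, hT, hC'⟩ := h1 Y hY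
      refine ⟨C, hC, fun x hx => ?_, fun x hx => ?_⟩
      · by_cases hxg : x = g
        · subst hxg; simp
        · rw [Function.update_of_ne hxg]
          exact hT x (Finset.mem_of_mem_insert_of_ne hx hxg)
      · rw [Finset.mem_insert, not_or] at hx
        rw [Function.update_of_ne hx.1]
        exact hC' x hx.2
    · rw [Finset.mem_insert, not_or] at hf
      obtain ⟨Y, hY, hYf, hYs⟩ := h2 C hC f hf.2 hCf
      obtain ⟨X, hX, hXf, hXs⟩ := exists_mem_contractCircuits hY hf.1 (by rwa [hYf])
      refine ⟨X, hX, hXf.trans hYf, fun x => ?_⟩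
      rcases hXs x with h | h
      · exact Or.inl h
      · rw [h]; exact hYs x

end Contraction

end OrientedMatroid

namespace OrientedMatroid

open SignedSet

/-! ### Orthogonality, four-painting and positive covectors. -/

section Duality

variable {α : Type*} {M : OrientedMatroid α}

theorem orthogonal_of_neg_left {X Y : α → SignType} (h : Orthogonal (-X) Y) : Orthogonal X Y := by
  rcases h with h | ⟨⟨e, he⟩, ⟨f, hf⟩⟩
  · exact Or.inl fun x => by simpa using h x
  · refine Or.inr ⟨⟨f, ?_⟩, ⟨e, ?_⟩⟩
    · simp only [Pi.neg_apply, neg_mul] at hf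
      exact neg_injective hf
    · simp only [Pi.neg_apply, neg_mul] at he
      rw [← he, neg_neg]

/-- In an oriented matroid of rank one, with set of loops `H`, there is a sign vector that
vanishes on `H`, is positive at `e`, and is orthogonal to every circuit. -/
theorem exists_orthogonal_of_rank_one {N : OrientedMatroid α} {H : Set α} {e : α}
    (hH : ∀ X ∈ N.circuits, ∀ x ∈ H, X x = 0)
    (heH : e ∉ H) (he : ∀ X ∈ N.circuits, X e ≠ 0 → ∃ f, f ≠ e ∧ X f ≠ 0)
    (hpar : ∀ f, f ∉ H → f ≠ e → ∃ X ∈ N.circuits, X e ≠ 0 ∧ ∀ x, x ≠ e → x ≠ f → X x = 0) :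
    ∃ Y ∈ N.orthogonalSet, Y e = 1 ∧ ∀ x ∈ H, Y x = 0 := by
  classical
  have hpar' : ∀ f, f ∉ H → f ≠ e → ∃ X ∈ N.circuits, X e = 1 ∧ X f ≠ 0 ∧
      ∀ x, x ≠ e → x ≠ f → X x = 0 := by
    intro f hf hfe
    obtain ⟨X, hX, hXe, hXs⟩ := hpar f hf hfe
    have hXf : X f ≠ 0 := by
      obtain ⟨y, hye, hXy⟩ := he X hX hXe
      intro hXf
      by_cases hyf : y = f
      · exact hXy (hyf ▸ hXf)
      · exact hXy (hXs y hye hyf)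
    rcases SignType.trichotomy (X e) with h | h | h
    · exact ⟨-X, N.neg_mem X hX, by rw [Pi.neg_apply, h, neg_neg], by simpa using hXf,
        fun x h1 h2 => by rw [Pi.neg_apply, hXs x h1 h2]; rfl⟩
    · exact absurd h hXe
    · exact ⟨X, hX, h, hXf, hXs⟩
  choose! K hK hKe hKf hKs using hpar'
  -- Orthogonality to the circuit `K f`, supported on `{e, f}` and positive at `e`, forces the sign
  -- at `f`.
  refine ⟨fun f => if f = e then 1 else if f ∈ H then 0 else -K f f, fun D hD => ?_, by simp,
    fun x hx => by simp [hx, show x ≠ e from fun h => heH (h ▸ hx)]⟩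
  have hoff : ∀ x, D x ≠ 0 → x ∉ H := fun x hx h => hx (hH D hD x h)
  by_cases hDe : D e = 0
  · obtain ⟨f, hf⟩ := exists_ne_zero_of_mem_circuits hD
    have hfe : f ≠ e := fun h => hf (h ▸ hDe)
    have hfH := hoff f hf
    obtain ⟨a, haf, hDa⟩ : ∃ a, a ≠ f ∧ D a ≠ 0 := by
      by_contra! hcon
      have := eq_zero_of_support_subset hD (hK f hfH hfe) (fun x hx => hcon x ?_) e hDe
      · rw [hKe f hfH hfe] at this; exact absurd this (by decide)
      · exact fun h => hKf f hfH hfe (h ▸ hx)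
    have hae : a ≠ e := fun h => hDa (h ▸ hDe)
    have haH := hoff a hDa
    -- Eliminating `e` between `K f` and `-K a` leaves a circuit inside `{f, a}`, which must be
    -- `±D`.
    obtain ⟨Z, hZ, hZe, hZs⟩ := exists_elimination (hK f hfH hfe)
      (N.neg_mem _ (hK a haH hae)) (e := e) (fun h => hKf f hfH hfe (by
        rw [← neg_injective h]; exact hKs a haH hae f hfe haf.symm))
      (by rw [hKe f hfH hfe]; decide) (by rw [Pi.neg_apply, hKe a haH hae, hKe f hfH hfe])
    have hZ0 : ∀ x, x ≠ f → x ≠ a → Z x = 0 := by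
      intro x hxf hxa
      by_cases hxe : x = e
      · rw [hxe, hZe]
      rcases hZs x with h | h | h
      · exact h
      · rw [h, hKs f hfH hfe x hxe hxf]
      · rw [h, Pi.neg_apply, hKs a haH hae x hxe hxa]; rfl
    have hZD : Z = D ∨ Z = -D := by
      refine N.eq_or_eq_neg Z hZ D hD fun x hx hDx => hx (hZ0 x ?_ ?_)
      · exact fun h => hf (h ▸ hDx)
      · exact fun h => hDa (h ▸ hDx)
    have hZf : Z f = K f f := by
      have h0 : Z f ≠ 0 := by rcases hZD with h | h <;> simpa [h] using hf
      rcases hZs f with h | h | h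
      · exact absurd h h0
      · exact h
      · rw [Pi.neg_apply, hKs a haH hae f hfe haf.symm] at h
        exact absurd h h0
    have hZa : Z a = -K a a := by
      have h0 : Z a ≠ 0 := by rcases hZD with h | h <;> simpa [h] using hDa
      rcases hZs a with h | h | h
      · exact absurd h h0
      · rw [hKs f hfH hfe a hae haf] at h
        exact absurd h h0
      · exact h
    have hsq : ∀ s : SignType, s ≠ 0 → s * s = 1 := by decide
    have hZY : Orthogonal Z (fun f => if f = e then 1 else if f ∈ H then 0 else -K f f) := by
      refine Or.inr ⟨⟨a, ?_⟩, ⟨f, ?_⟩⟩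
      · simp [hae, haH, hZa, hsq _ (hKf a haH hae)]
      · simp [hfe, hfH, hZf, hsq _ (hKf f hfH hfe)]
    rcases hZD with h | h
    · exact h ▸ hZY
    · exact orthogonal_of_neg_left (h ▸ hZY)
  · obtain ⟨f, hfe, hDf⟩ := he D hD hDe
    have hfH := hoff f hDf
    have hKY : Orthogonal (K f) (fun f => if f = e then 1 else if f ∈ H then 0 else -K f f) := by
      have hsq : ∀ s : SignType, s ≠ 0 → s * s = 1 := by decide
      refine Or.inr ⟨⟨e, ?_⟩, ⟨f, ?_⟩⟩
      · simp [hKe f hfH hfe]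
      · simp [hfe, hfH, hsq _ (hKf f hfH hfe)]
    have : K f = D ∨ K f = -D := by
      refine N.eq_or_eq_neg _ (hK f hfH hfe) D hD fun x hx hDx => hx (hKs f hfH hfe x ?_ ?_)
      · exact fun h => hDe (h ▸ hDx)
      · exact fun h => hDf (h ▸ hDx)
    rcases this with h | h
    · exact h ▸ hKY
    · exact orthogonal_of_neg_left (h ▸ hKY)

/-- If `e` is not in the closure of `G`, then some cocircuit contains `e` and avoids `G`. -/
theorem exists_cocircuit_of_notMem_closure [Finite α] {G : Set α} {e : α} (heG : e ∉ G)
    (hG : ∀ C ∈ M.circuits, C e ≠ 0 → ∃ x, x ≠ e ∧ x ∉ G ∧ C x ≠ 0) :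
    ∃ Y ∈ M.cocircuits, Y e = 1 ∧ ∀ x ∈ G, Y x = 0 := by
  classical
  -- `H` is a hyperplane: by maximality, adding any further `f ≠ e` brings `e` into the closure.
  obtain ⟨H, ⟨hGH, heH, hH⟩, hmax⟩ := Set.Finite.exists_maximal (s := {H : Set α | G ⊆ H ∧ e ∉ H ∧
    ∀ C ∈ M.circuits, C e ≠ 0 → ∃ x, x ≠ e ∧ x ∉ H ∧ C x ≠ 0}) (Set.toFinite _)
    ⟨G, subset_rfl, heG, hG⟩
  have hpar : ∀ f, f ∉ H → f ≠ e → ∃ C ∈ M.circuits, C e ≠ 0 ∧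
      ∀ x, x ≠ e → x ≠ f → x ∉ H → C x = 0 := by
    intro f hf hfe
    by_contra! hcon
    refine hf (hmax (y := insert f H) ⟨hGH.trans (Set.subset_insert _ _), ?_, fun C hC hCe => ?_⟩
      (Set.subset_insert _ _) (Set.mem_insert _ _))
    · rw [Set.mem_insert_iff, not_or]; exact ⟨hfe.symm, heH⟩
    · obtain ⟨x, hxe, hxf, hxH, hCx⟩ := hcon C hC hCe
      exact ⟨x, hxe, by rw [Set.mem_insert_iff, not_or]; exact ⟨hxf, hxH⟩, hCx⟩
  obtain ⟨N, hN1, hN2⟩ := M.exists_contraction (Set.toFinite H).toFinset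
  simp only [Set.Finite.mem_toFinset] at hN1 hN2
  obtain ⟨Y, hY, hYe, hYH⟩ := exists_orthogonal_of_rank_one (N := N) (H := H) (e := e)
    (fun X hX => by obtain ⟨C, -, h, -⟩ := hN1 X hX; exact h) heH
    (fun X hX hXe => by
      obtain ⟨C, hC, -, h⟩ := hN1 X hX
      obtain ⟨x, hxe, hxH, hCx⟩ := hH C hC (h e heH ▸ hXe)
      exact ⟨x, hxe, by rwa [h x hxH]⟩)
    (fun f hf hfe => by
      obtain ⟨C, hC, hCe, hCs⟩ := hpar f hf hfe
      obtain ⟨X, hX, hXe, hXs⟩ := hN2 C hC e heH hCe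
      refine ⟨X, hX, by rwa [hXe], fun x hxe hxf => ?_⟩
      by_cases hxH : x ∈ H
      · obtain ⟨D, -, h, -⟩ := hN1 X hX
        exact h x hxH
      · rcases hXs x with h | h
        · exact h
        · rw [h, hCs x hxe hxf hxH])
  -- If `C` meets `Y` at `f`, a circuit of the contraction through `f` conforming to `C` passes its
  -- two witnesses on to `C`.
  have hYM : Y ∈ M.orthogonalSet := by
    intro C hC
    by_cases h0 : ∀ x, C x * Y x = 0
    · exact Or.inl h0
    push Not at h0
    obtain ⟨f, hf⟩ := h0
    have hCf : C f ≠ 0 := fun h => hf (by rw [h, zero_mul])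
    have hYf : Y f ≠ 0 := fun h => hf (by rw [h, mul_zero])
    obtain ⟨X, hX, hXf, hXs⟩ := hN2 C hC f (fun h => hYf (hYH f h)) hCf
    rcases hY X hX with h | ⟨⟨a, ha⟩, ⟨b, hb⟩⟩
    · exact absurd (hXf ▸ h f) hf
    · refine Or.inr ⟨⟨a, ?_⟩, ⟨b, ?_⟩⟩
      · rcases hXs a with h | h
        · simp [h] at ha
        · rwa [← h]
      · rcases hXs b with h | h
        · rw [h, zero_mul] at hb; exact absurd hb (by decide)
        · rwa [← h]
  -- For `f ≠ e`, a circuit inside `{e, f} ∪ H` meets `Z` at most in `e` and `f`, so orthogonality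
  -- forbids meeting it in just one. This makes the support of `Y` minimal.
  have hmeet : ∀ Z ∈ M.orthogonalSet, support Z ⊆ support Y →
      ∀ f, f ∉ H → (Z e ≠ 0 ↔ Z f ≠ 0) := by
    intro Z hZ hZY f hf
    by_cases hfe : f = e
    · rw [hfe]
    obtain ⟨C, hC, hCe, hCs⟩ := hpar f hf hfe
    have hCf : C f ≠ 0 := by
      obtain ⟨x, hxe, hxH, hCx⟩ := hH C hC hCe
      intro h
      by_cases hxf : x = f
      · exact hCx (hxf ▸ h)
      · exact hCx (hCs x hxe hxf hxH)
    have hprod : ∀ x, x ≠ e → x ≠ f → C x * Z x = 0 := by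
      intro x hxe hxf
      by_cases hxH : x ∈ H
      · have : Z x = 0 := by
          by_contra h
          exact hZY h (hYH x hxH)
        rw [this, mul_zero]
      · rw [hCs x hxe hxf hxH, zero_mul]
    have mem : ∀ x, C x * Z x ≠ 0 → x = e ∨ x = f := by
      intro x hx
      by_contra! h
      exact hx (hprod x h.1 h.2)
    rcases hZ C hC with h | ⟨⟨a, ha⟩, ⟨b, hb⟩⟩
    · have h1 := h e
      have h2 := h f
      rw [mul_eq_zero] at h1 h2
      simp [h1.resolve_left hCe, h2.resolve_left hCf]
    · have hab : a ≠ b := by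
        rintro rfl
        rw [ha] at hb
        exact absurd hb (by decide)
      have ha0 : C a * Z a ≠ 0 := by rw [ha]; decide
      have hb0 : C b * Z b ≠ 0 := by rw [hb]; decide
      have hZa := right_ne_zero_of_mul ha0
      have hZb := right_ne_zero_of_mul hb0
      rcases mem a ha0 with rfl | rfl <;> rcases mem b hb0 with rfl | rfl
      · exact absurd rfl hab
      · simp [hZa, hZb]
      · simp [hZa, hZb]
      · exact absurd rfl hab
  refine ⟨Y, ⟨hYM, fun h => ?_, fun Z hZ hZ0 hZY => hZY.antisymm fun f hf => ?_⟩, hYe,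
    fun x hx => hYH x (hGH hx)⟩
  · rw [h, Pi.zero_apply] at hYe; exact absurd hYe (by decide)
  · obtain ⟨y, hy⟩ := Function.ne_iff.1 hZ0
    have hyH : y ∉ H := fun h => hZY hy (hYH y h)
    have hfH : f ∉ H := fun h => hf (hYH f h)
    exact (hmeet Z hZ hZY f hfH).1 ((hmeet Z hZ hZY y hyH).2 hy)

/-- The four-painting lemma: `B` is the set of black elements other than `e`, the elements of `G` are
free in circuits and excluded from cocircuits, and the remaining ones are excluded from circuits and
free in cocircuits. -/
theorem exists_circuit_or_cocircuit [Finite α] (B : Finset α) (G : Set α) (e : α) (heB : e ∉ B)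
    (heG : e ∉ G) (hBG : ∀ x ∈ B, x ∉ G) :
    (∃ C ∈ M.circuits, C e = 1 ∧ (∀ x ∈ B, C x ≠ -1) ∧
      ∀ x, x ≠ e → x ∉ B → x ∉ G → C x = 0) ∨
    ∃ Y ∈ M.cocircuits, Y e = 1 ∧ (∀ x ∈ B, Y x ≠ -1) ∧ ∀ x ∈ G, Y x = 0 := by
  classical
  induction B using Finset.induction_on generalizing G with
  | empty =>
    rw [or_iff_not_imp_left]
    intro hcon
    obtain ⟨Y, hY, hYe, hYG⟩ := exists_cocircuit_of_notMem_closure (M := M) heG (fun C hC hCe => by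
      by_contra! h
      rcases SignType.trichotomy (C e) with h' | h' | h'
      · exact hcon ⟨-C, M.neg_mem C hC, by rw [Pi.neg_apply, h', neg_neg], by simp,
          fun x hx _ hxG => by rw [Pi.neg_apply, h x hx hxG]; rfl⟩
      · exact hCe h'
      · exact hcon ⟨C, hC, h', by simp, fun x hx _ hxG => h x hx hxG⟩)
    exact ⟨Y, hY, hYe, by simp, hYG⟩
  | insert f B hfB ih =>
    rw [Finset.mem_insert, not_or] at heB
    have hfG := hBG f (Finset.mem_insert_self _ _)
    -- Recolor `f` in both ways: here it is excluded from circuits and free in cocircuits, below it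
    -- is the reverse.
    rcases ih G heB.2 heG (fun x hx => hBG x (Finset.mem_insert_of_mem hx)) with
      ⟨C, hC, hCe, hCB, hCs⟩ | ⟨Y, hY, hYe, hYB, hYG⟩
    · have hCf : C f = 0 := hCs f (Ne.symm heB.1) hfB hfG
      refine Or.inl ⟨C, hC, hCe, fun x hx => ?_, fun x hxe hxB hxG => ?_⟩
      · rcases Finset.mem_insert.1 hx with rfl | hx
        · rw [hCf]; decide
        · exact hCB x hx
      · exact hCs x hxe (fun h => hxB (Finset.mem_insert_of_mem h)) hxG
    rcases ih (insert f G) heB.2 (by simp [heB.1, heG]) (fun x hx => by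
      rw [Set.mem_insert_iff, not_or]
      exact ⟨fun h => hfB (h ▸ hx), hBG x (Finset.mem_insert_of_mem hx)⟩) with
      ⟨C, hC, hCe, hCB, hCs⟩ | ⟨Z, hZ, hZe, hZB, hZG⟩
    swap
    · refine Or.inr ⟨Z, hZ, hZe, fun x hx => ?_, fun x hx => hZG x (Set.mem_insert_of_mem _ hx)⟩
      rcases Finset.mem_insert.1 hx with rfl | hx
      · rw [hZG x (Set.mem_insert _ _)]; decide
      · exact hZB x hx
    by_cases hYf : Y f = -1
    swap
    · refine Or.inr ⟨Y, hY, hYe, fun x hx => ?_, hYG⟩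
      rcases Finset.mem_insert.1 hx with rfl | hx
      · exact hYf
      · exact hYB x hx
    by_cases hCf : C f = -1
    swap
    · refine Or.inl ⟨C, hC, hCe, fun x hx => ?_, fun x hxe hxB hxG => ?_⟩
      · rcases Finset.mem_insert.1 hx with rfl | hx
        · exact hCf
        · exact hCB x hx
      · rw [Finset.mem_insert, not_or] at hxB
        exact hCs x hxe hxB.2 (by simp [hxB.1, hxG])
    -- Both `C` and `Y` are negative at `f`; their product is `1` at `e` and nowhere `-1`, against
    -- orthogonality.
    exfalso
    have hnn : ∀ x, C x * Y x ≠ -1 := by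
      intro x
      by_cases hxe : x = e
      · rw [hxe, hCe, hYe]; decide
      by_cases hxf : x = f
      · rw [hxf, hCf, hYf]; decide
      by_cases hxB : x ∈ B
      · have h1 := hCB x hxB
        have h2 := hYB x hxB
        revert h1 h2
        generalize C x = a
        generalize Y x = b
        revert a b
        decide
      by_cases hxG : x ∈ G
      · rw [hYG x hxG, mul_zero]; decide
      · rw [hCs x hxe hxB (by simp [hxf, hxG]), zero_mul]; decide
    rcases hY.1 C hC with h | ⟨-, ⟨b, hb⟩⟩
    · have := h e
      rw [hCe, hYe] at this
      exact absurd this (by decide)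
    · exact hnn b hb

/-- If `C` meets `X`, the two witnesses for `X` persist; if it does not, `C` sees only `Y` in the
composition. -/
theorem orthogonal_comp {C X Y : α → SignType} (hX : Orthogonal C X) (hY : Orthogonal C Y) :
    Orthogonal C (SignedSet.comp X Y) := by
  have hof : ∀ x, C x * X x ≠ 0 → SignedSet.comp X Y x = X x :=
    fun x hx => if_pos (right_ne_zero_of_mul hx)
  rcases hX with hX | ⟨⟨a, ha⟩, ⟨b, hb⟩⟩
  · have h : ∀ x, C x * SignedSet.comp X Y x = C x * Y x := by
      intro x
      rcases mul_eq_zero.1 (hX x) with h | h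
      · rw [h, zero_mul, zero_mul]
      · simp [SignedSet.comp, h]
    simpa only [Orthogonal, h] using hY
  · exact Or.inr ⟨⟨a, by rw [hof a (by rw [ha]; decide), ha]⟩,
      ⟨b, by rw [hof b (by rw [hb]; decide), hb]⟩⟩

theorem IsCovector.mem_orthogonalSet {Y : α → SignType} (hY : M.IsCovector Y) :
    Y ∈ M.orthogonalSet := by
  induction hY with
  | zero => exact fun C _ => Or.inl fun x => mul_zero _
  | comp X Y hX _ ih => exact fun C hC => orthogonal_comp (hX.1 C hC) (ih C hC)

/-- If no circuit is positive off `F` and meets the complement of `F`, then some positive covector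
has zero set `F`. -/
theorem exists_isCovector_zeroSet_eq [Finite α] {F : Set α}
    (hF : ∀ C ∈ M.circuits, (∃ e, e ∉ F ∧ C e ≠ 0) → ∃ e, e ∉ F ∧ C e = -1) :
    ∃ Y, M.IsCovector Y ∧ IsPositive Y ∧ zeroSet Y = F := by
  classical
  -- Paint `Fᶜ \ {e}` black and leave `F` free in circuits: the circuit alternative is what `hF`
  -- forbids. Composing these cocircuits over all `e ∉ F` then fills `Fᶜ`.
  have hcoc : ∀ e, e ∉ F → ∃ Y ∈ M.cocircuits, Y e = 1 ∧ IsPositive Y ∧ ∀ x ∈ F, Y x = 0 := by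
    intro e he
    rcases exists_circuit_or_cocircuit (M := M) (Set.toFinite (F ∪ {e})ᶜ).toFinset F e (by simp) he
      (by simp) with ⟨C, hC, hCe, hCB, -⟩ | ⟨Y, hY, hYe, hYB, hYF⟩
    · obtain ⟨x, hxF, hCx⟩ := hF C hC ⟨e, he, by rw [hCe]; decide⟩
      by_cases hxe : x = e
      · rw [hxe, hCe] at hCx; exact absurd hCx (by decide)
      · exact absurd hCx (hCB x (by simp [hxe, hxF]))
    · refine ⟨Y, hY, hYe, fun x => ?_, hYF⟩
      by_cases hxF : x ∈ F
      · exact Or.inr (hYF x hxF)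
      by_cases hxe : x = e
      · rw [hxe]; exact Or.inl hYe
      · have := hYB x (by simp [hxe, hxF])
        rcases SignType.trichotomy (Y x) with h | h | h <;> tauto
  have key : ∀ S : Finset α, (∀ x ∈ S, x ∉ F) → ∃ Y, M.IsCovector Y ∧ IsPositive Y ∧
      (∀ x ∈ F, Y x = 0) ∧ ∀ x ∈ S, Y x = 1 := by
    intro S
    induction S using Finset.induction_on with
    | empty => exact fun _ => ⟨0, .zero, fun _ => Or.inr rfl, by simp, by simp⟩
    | insert e S _ ih =>
      intro hS
      obtain ⟨Y, hY, hYp, hYF, hYS⟩ := ih fun x hx => hS x (Finset.mem_insert_of_mem hx)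
      obtain ⟨X, hX, hXe, hXp, hXF⟩ := hcoc e (hS e (Finset.mem_insert_self _ _))
      refine ⟨SignedSet.comp X Y, .comp X Y hX hY, fun x => ?_, fun x hx => ?_, fun x hx => ?_⟩
      · by_cases h : X x = 0
        · simpa [SignedSet.comp, h] using hYp x
        · simpa [SignedSet.comp, h] using hXp x
      · simp [SignedSet.comp, hXF x hx, hYF x hx]
      · by_cases h : X x = 0
        · rcases Finset.mem_insert.1 hx with rfl | hx
          · rw [h] at hXe; exact absurd hXe (by decide)
          · simp [SignedSet.comp, h, hYS x hx]
        · simpa [SignedSet.comp, h] using (hXp x).resolve_right h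
  obtain ⟨Y, hY, hYp, hYF, hYS⟩ := key (Set.toFinite Fᶜ).toFinset (by simp)
  refine ⟨Y, hY, hYp, Set.ext fun x => ⟨fun hx => ?_, fun hx => hYF x hx⟩⟩
  by_contra hxF
  have := hYS x (by simpa using hxF)
  rw [show Y x = 0 from hx] at this
  exact absurd this (by decide)

end Duality

/-! ### Initial forms of circuits and positive flats. -/

section Initial

variable {α : Type*} {M : OrientedMatroid α}

theorem isPositive_of_isSubset {X Y : α → SignType} (hY : IsPositive Y) (h : IsSubset X Y) :
    IsPositive X := by
  intro e
  have h1 := hY e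
  have h2 := h e
  revert h1 h2
  generalize X e = a
  generalize Y e = b
  revert a b
  decide

/-- `M_ω` is acyclic if and only if no initial form of a circuit is positive. -/
theorem isAcyclic_initialCircuits_iff [Finite α] (ω : α → ℝ) :
    SignedSet.IsAcyclic (M.initialCircuits ω) ↔
      ∀ C ∈ M.circuits, ¬ IsPositive (initial ω C) := by
  classical
  constructor
  · intro h C hC hpos
    -- Signed subsets of a positive set are positive, so minimal support among positive initial
    -- forms gives minimality among all of them.
    let S := {Y | Y ∈ initial ω '' M.circuits ∧ IsPositive Y}
    obtain ⟨Y, ⟨hY, hYp⟩, hmin⟩ := Set.exists_min_image S (fun Y => (support Y).ncard)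
      (Set.toFinite S) ⟨_, ⟨C, hC, rfl⟩, hpos⟩
    refine h Y ⟨hY, fun Z hZ hZY => ?_⟩ hYp
    have hZp := isPositive_of_isSubset hYp hZY
    have hsub : support Z ⊆ support Y := by
      intro e he
      have h1 := hZY e
      simp only [support, Set.mem_ofPred_eq] at he ⊢
      revert h1 he
      generalize Z e = a
      generalize Y e = b
      revert a b
      decide
    have heq := Set.eq_of_subset_of_ncard_le hsub (hmin Z ⟨hZ, hZp⟩) (Set.toFinite _)
    funext e
    have h1 := hZp e
    have h2 := hYp e
    have h3 : Z e ≠ 0 ↔ Y e ≠ 0 := Set.ext_iff.1 heq e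
    revert h1 h2 h3
    generalize Z e = a
    generalize Y e = b
    revert a b
    decide
  · rintro h Y ⟨⟨C, hC, rfl⟩, -⟩
    exact h C hC

theorem isPositive_initial {ω : α → ℝ} {C : α → SignType} (h : IsPositive C) :
    IsPositive (initial ω C) := by
  intro e
  unfold initial
  split_ifs
  · exact h e
  · exact Or.inr rfl

theorem exists_max_weight [Finite α] (ω : α → ℝ) {C : α → SignType} (hC : C ∈ M.circuits) :
    ∃ e, C e ≠ 0 ∧ ∀ f, C f ≠ 0 → ω f ≤ ω e :=
  Set.exists_max_image (support C) ω (Set.toFinite _) (exists_ne_zero_of_mem_circuits hC)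

/-- The initial circuits of `ω` are acyclic if and only if all sublevel sets of `ω` are positive
flats. -/
theorem isAcyclic_initialCircuits_iff_isPositiveFlat [Finite α] (hM : M.IsAcyclic) (ω : α → ℝ) :
    SignedSet.IsAcyclic (M.initialCircuits ω) ↔ ∀ F ∈ weightFlag ω, M.IsPositiveFlat F := by
  classical
  rw [isAcyclic_initialCircuits_iff]
  -- The condition applied to `C` and `-C` yields both signs off `F`, hence two elements there; so
  -- `F` is a flat.
  have main : ∀ F : Set α, (∀ C ∈ M.circuits, (∃ e, e ∉ F ∧ C e ≠ 0) → ∃ e, e ∉ F ∧ C e = -1) →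
      M.IsPositiveFlat F := by
    intro F hF
    refine ⟨fun C hC => ?_, Or.inr (exists_isCovector_zeroSet_eq hF)⟩
    rintro ⟨e, ⟨he, heF⟩, huniq⟩
    obtain ⟨a, haF, ha⟩ := hF C hC ⟨e, heF, he⟩
    obtain ⟨b, hbF, hb⟩ := hF (-C) (M.neg_mem C hC) ⟨e, heF, by simpa [support] using he⟩
    have h1 := huniq a ⟨by simp [support, ha], haF⟩
    have hb' : C b = 1 := neg_injective hb
    have h2 := huniq b ⟨by simp [support, hb'], hbF⟩
    rw [h1, ← h2, hb'] at ha
    exact absurd ha (by decide)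
  constructor
  · rintro h F (rfl | ⟨t, rfl⟩)
    · refine main ∅ fun C hC _ => ?_
      by_contra! hcon
      refine hM C hC fun e => ?_
      have := hcon e (Set.notMem_empty e)
      rcases SignType.trichotomy (C e) with h | h | h <;> tauto
    · refine main _ fun C hC => ?_
      rintro ⟨e, he, hCe⟩
      obtain ⟨m, hm, hmax⟩ := exists_max_weight ω hC
      by_contra! hcon
      refine h C hC fun x => ?_
      unfold initial
      split_ifs with hx
      · have h1 := hcon x (by
          have := hx e hCe
          simp only [Set.mem_ofPred_eq, not_le] at he ⊢
          linarith)
        rcases SignType.trichotomy (C x) with h | h | h <;> tauto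
      · exact Or.inr rfl
  · intro h C hC hpos
    obtain ⟨m, hm, hmax⟩ := exists_max_weight ω hC
    have hpos' : ∀ x, ω m ≤ ω x → C x = 1 ∨ C x = 0 := by
      intro x hx
      have := hpos x
      unfold initial at this
      rwa [if_pos (show ∀ f ∈ support C, ω f ≤ ω x from fun f hf => (hmax f hf).trans hx)] at this
    -- Take `{ω < ω m}`: the sublevel set at the largest smaller weight, or `∅` if there is none.
    have hcl : ∃ F ∈ weightFlag ω, m ∉ F ∧ ∀ x, x ∉ F → C x = 1 ∨ C x = 0 := by
      by_cases hlow : ∃ x, ω x < ω m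
      · obtain ⟨a, ha, hamax⟩ := Set.exists_max_image {x | ω x < ω m} ω (Set.toFinite _) hlow
        refine ⟨_, Or.inr ⟨ω a, rfl⟩, by simpa using ha, fun x hx => hpos' x ?_⟩
        by_contra! hlt
        exact hx (hamax x hlt)
      · push Not at hlow
        exact ⟨∅, Or.inl rfl, Set.notMem_empty _, fun x _ => hpos' x (hlow x)⟩
    obtain ⟨F, hF, hmF, hCF⟩ := hcl
    rcases (h F hF).2 with rfl | ⟨Y, hY, hYp, rfl⟩
    · exact hmF (Set.mem_univ m)
    · have hprod : ∀ x, C x * Y x ≠ -1 := by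
        intro x
        have h1 := hYp x
        by_cases hx : Y x = 0
        · rw [hx, mul_zero]; decide
        · have h2 := hCF x hx
          revert h1 h2
          generalize C x = a
          generalize Y x = b
          revert a b
          decide
      rcases hY.mem_orthogonalSet C hC with h0 | ⟨-, ⟨b, hb⟩⟩
      · rcases mul_eq_zero.1 (h0 m) with h0 | h0
        · exact hm h0
        · exact hmF h0
      · exact hprod b hb

/-- For the zero weight, initial forms are the circuits themselves, and `∅` belongs to every flag.
-/
theorem isPositiveFlat_empty [Finite α] (hM : M.IsAcyclic) : M.IsPositiveFlat ∅ := by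
  refine (isAcyclic_initialCircuits_iff_isPositiveFlat hM 0).1
    ((isAcyclic_initialCircuits_iff _).2 fun C hC hpos => hM C hC fun e => ?_) ∅ (Or.inl rfl)
  have := hpos e
  unfold initial at this
  rwa [if_pos (show ∀ f ∈ support C, (0 : α → ℝ) f ≤ (0 : α → ℝ) e from fun f _ => le_rfl)] at this

theorem isPositiveFlat_univ : M.IsPositiveFlat Set.univ :=
  ⟨fun _ _ ⟨e, he, _⟩ => he.2 (Set.mem_univ e), Or.inl rfl⟩

theorem isBot_lasVergnasLattice_iff [Finite α] (hM : M.IsAcyclic) (F : M.LasVergnasLattice) :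
    IsBot F ↔ F.1 = ∅ :=
  ⟨fun h => Set.subset_empty_iff.1 (h ⟨∅, isPositiveFlat_empty hM⟩),
    fun h G => show F.1 ⊆ G.1 by rw [h]; exact Set.empty_subset _⟩

theorem isTop_lasVergnasLattice_iff (F : M.LasVergnasLattice) : IsTop F ↔ F.1 = Set.univ :=
  ⟨fun h => Set.univ_subset_iff.1 (h ⟨Set.univ, isPositiveFlat_univ⟩),
    fun h G => show G.1 ⊆ F.1 by rw [h]; exact Set.subset_univ _⟩

end Initial

end OrientedMatroid

/-! ### Flags of weight vectors. -/

section WeightFlag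

variable {α : Type*}

theorem weightFlag_chain {ω : α → ℝ} {A B : Set α} (hA : A ∈ weightFlag ω)
    (hB : B ∈ weightFlag ω) : A ⊆ B ∨ B ⊆ A := by
  rcases hA with rfl | ⟨s, rfl⟩
  · exact Or.inl (Set.empty_subset _)
  rcases hB with rfl | ⟨t, rfl⟩
  · exact Or.inr (Set.empty_subset _)
  rcases le_total s t with h | h
  · exact Or.inl fun x (hx : ω x ≤ s) => hx.trans h
  · exact Or.inr fun x (hx : ω x ≤ t) => hx.trans h

theorem univ_mem_weightFlag [Finite α] (ω : α → ℝ) : Set.univ ∈ weightFlag ω := by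
  rcases isEmpty_or_nonempty α with h | h
  · exact Or.inl (Set.univ_eq_empty_iff.2 h)
  · obtain ⟨a, ha⟩ := Finite.exists_max ω
    exact Or.inr ⟨ω a, (Set.eq_univ_of_forall fun x => ha x).symm⟩

theorem weightFlag_affine (ω : α → ℝ) {a : ℝ} (ha : 0 < a) (b : ℝ) :
    weightFlag (fun i => a * (ω i - b)) = weightFlag ω := by
  unfold weightFlag
  congr 1
  ext A
  constructor
  · rintro ⟨t, rfl⟩
    refine ⟨t / a + b, Set.ext fun i => ?_⟩
    simp only [Set.mem_ofPred_eq]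
    rw [← sub_le_iff_le_add, le_div_iff₀' ha]
  · rintro ⟨t, rfl⟩
    refine ⟨a * (t - b), Set.ext fun i => ?_⟩
    simp only [Set.mem_ofPred_eq]
    rw [mul_le_mul_iff_right₀ ha, sub_le_sub_iff_right]

end WeightFlag

/-! ### Weights as combinations of indicators along a chain. -/

section Profile

variable {α V : Type*} [Fintype V] (F : V → Set α)

/-- The weight vector `∑ v, x v • 1_{(F v)ᶜ}`. -/
noncomputable def profile (x : V → ℝ) (i : α) : ℝ := ∑ v, x v * (F v)ᶜ.indicator 1 i

variable {F} {x : V → ℝ}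

/-- No member of the chain contributes less at `k` than at `j`: if it misses `j`, it lies inside `F
v` and so misses `k`. The member `F v` contributes `x v` more. -/
theorem profile_add_le (hx : ∀ v, 0 ≤ x v)
    (hchain : ∀ v w, x v ≠ 0 → x w ≠ 0 → F v ⊆ F w ∨ F w ⊆ F v) {v : V} (hv : x v ≠ 0) {j k : α}
    (hj : j ∈ F v) (hk : k ∉ F v) : profile F x j + x v ≤ profile F x k := by
  classical
  have h1 : x v = ∑ w, if w = v then x v else 0 := by simp
  rw [profile, profile, h1, ← Finset.sum_add_distrib]
  refine Finset.sum_le_sum fun w _ => ?_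
  by_cases hwv : w = v
  · subst hwv
    simp [hj, hk]
  by_cases hw : x w = 0
  · simp [hw, hwv]
  by_cases hjw : j ∈ F w
  · have : 0 ≤ x w * (F w)ᶜ.indicator 1 k :=
      mul_nonneg (hx w) (Set.indicator_nonneg (fun _ _ => zero_le_one) _)
    simpa [hjw, hwv] using this
  · have hkw : k ∉ F w := fun h => by
      rcases hchain v w hv hw with h' | h'
      · exact hjw (h' hj)
      · exact hk (h' h)
    simp [hjw, hkw, hwv]

theorem profile_lt (hx : ∀ v, 0 ≤ x v)
    (hchain : ∀ v w, x v ≠ 0 → x w ≠ 0 → F v ⊆ F w ∨ F w ⊆ F v) {v : V} (hv : x v ≠ 0) {j k : α}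
    (hj : j ∈ F v) (hk : k ∉ F v) : profile F x j < profile F x k := by
  have h1 := profile_add_le hx hchain hv hj hk
  have h2 := lt_of_le_of_ne (hx v) hv.symm
  linarith

/-- The coefficient of a member of the chain is the jump of the weights at this member. -/
theorem profile_eq_add (hF : Function.Injective F) (hx : ∀ v, 0 ≤ x v)
    (hchain : ∀ v w, x v ≠ 0 → x w ≠ 0 → F v ⊆ F w ∨ F w ⊆ F v) {v : V} {j k : α}
    (hv : x v ≠ 0) (hj : j ∈ F v) (hjmax : ∀ i ∈ F v, profile F x i ≤ profile F x j)
    (hk : k ∉ F v) (hkmin : ∀ i, i ∉ F v → profile F x k ≤ profile F x i) :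
    profile F x k = profile F x j + x v := by
  classical
  have h1 : x v = ∑ w, if w = v then x v else 0 := by simp
  rw [h1, profile, profile, ← Finset.sum_add_distrib]
  refine Finset.sum_congr rfl fun w _ => ?_
  by_cases hwv : w = v
  · subst hwv
    simp [hj, hk]
  by_cases hw : x w = 0
  · simp [hw, hwv]
  -- No other member separates `j` from `k`: one that did would put a point strictly between `F v`
  -- and the extremal `j` or `k`.
  have hne : F w ≠ F v := fun h => hwv (hF h)
  rcases hchain v w hv hw with h | h
  · have hjw := h hj
    obtain ⟨i, hiw, hiv⟩ := Set.not_subset.1 fun h' => hne (h'.antisymm h)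
    have hkw : k ∈ F w := by
      by_contra hkw
      exact absurd (hkmin i hiv) (not_le.2 (profile_lt hx hchain hw hiw hkw))
    simp [hjw, hkw, hwv]
  · have hkw : k ∉ F w := fun h' => hk (h h')
    obtain ⟨i, hiv, hiw⟩ := Set.not_subset.1 fun h' => hne (h.antisymm h')
    have hjw : j ∉ F w := fun hjw =>
      absurd (hjmax i hiv) (not_le.2 (profile_lt hx hchain hw hjw hiw))
    simp [hjw, hkw, hwv]

theorem mem_weightFlag_profile_iff [Finite α] (hx : ∀ v, 0 ≤ x v)
    (hchain : ∀ v w, x v ≠ 0 → x w ≠ 0 → F v ⊆ F w ∨ F w ⊆ F v) {A : Set α} :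
    A ∈ weightFlag (profile F x) ↔ A = ∅ ∨ A = Set.univ ∨ ∃ v, x v ≠ 0 ∧ F v = A := by
  constructor
  · rintro (rfl | ⟨t, rfl⟩)
    · exact Or.inl rfl
    rw [or_iff_not_imp_left, or_iff_not_imp_left]
    intro h0 h1
    obtain ⟨j, hj, hjmax⟩ := Set.exists_max_image {e | profile F x e ≤ t} (profile F x)
      (Set.toFinite _) (Set.nonempty_iff_ne_empty.2 h0)
    obtain ⟨k, hk, hkmin⟩ := Set.exists_min_image {e | profile F x e ≤ t}ᶜ (profile F x)
      (Set.toFinite _) (Set.nonempty_compl.2 h1)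
    simp only [Set.mem_compl_iff, Set.mem_ofPred_eq, not_le] at hj hk hjmax hkmin
    -- Between the heaviest `j` inside and the lightest `k` outside, some member must jump; it is
    -- the sublevel set itself.
    obtain ⟨v, -, hv⟩ := Finset.exists_lt_of_sum_lt (hj.trans_lt hk)
    have hv0 : x v ≠ 0 := fun h => by simp [h] at hv
    have hkv : k ∉ F v := by
      intro h
      have : 0 ≤ x v * (F v)ᶜ.indicator 1 j :=
        mul_nonneg (hx v) (Set.indicator_nonneg (fun _ _ => zero_le_one) _)
      simp only [Set.mem_compl_iff, h, not_true_eq_false, not_false_eq_true,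
        Set.indicator_of_notMem, mul_zero] at hv
      linarith
    have hjv : j ∈ F v := by
      by_contra h
      simp [h, hkv] at hv
    refine ⟨v, hv0, Set.ext fun i => ⟨fun hi => ?_, fun hi => ?_⟩⟩
    · by_contra hit
      have h1 := profile_lt hx hchain hv0 hi hkv
      have h2 := hkmin i (not_le.1 hit)
      linarith
    · by_contra hiv
      have h1 := profile_lt hx hchain hv0 hjv hiv
      have h2 := hjmax i hi
      linarith
  · rintro (rfl | rfl | ⟨v, hv, rfl⟩)
    · exact Or.inl rfl
    · exact univ_mem_weightFlag _
    · rcases (F v).eq_empty_or_nonempty with h | h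
      · exact Or.inl h
      obtain ⟨j, hj, hjmax⟩ := Set.exists_max_image (F v) (profile F x) (Set.toFinite _) h
      refine Or.inr ⟨profile F x j, Set.ext fun i => ⟨fun hi => hjmax i hi, fun hi => ?_⟩⟩
      by_contra hiv
      exact absurd hi (not_le.2 (profile_lt hx hchain hv hj hiv))

theorem ne_zero_iff_mem_weightFlag_profile [Finite α] (hF : Function.Injective F)
    (h0 : ∀ v, F v ≠ ∅) (h1 : ∀ v, F v ≠ Set.univ) (hx : ∀ v, 0 ≤ x v)
    (hchain : ∀ v w, x v ≠ 0 → x w ≠ 0 → F v ⊆ F w ∨ F w ⊆ F v) (v : V) :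
    x v ≠ 0 ↔ F v ∈ weightFlag (profile F x) := by
  rw [mem_weightFlag_profile_iff hx hchain]
  constructor
  · exact fun h => Or.inr (Or.inr ⟨v, h, rfl⟩)
  · rintro (h | h | ⟨w, hw, h⟩)
    · exact absurd h (h0 v)
    · exact absurd h (h1 v)
    · rwa [← hF h]

/-- A weight vector is determined up to a constant by its jumps at the members of its flag. -/
theorem exists_profile_eq [Fintype α] (F : V → Set α) (ω : α → ℝ)
    (hω : ∀ A ∈ weightFlag ω, A ≠ ∅ → A ≠ Set.univ → ∃ v, F v = A) :
    ∃ x : V → ℝ, (∀ v, 0 ≤ x v) ∧ (∀ v, x v ≠ 0 → F v ∈ weightFlag ω) ∧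
      ∃ c, ∀ i, ω i = profile F x i + c := by
  classical
  -- Induct on the number of values: truncating at the second largest value removes the top jump,
  -- which is restored as a coefficient.
  induction hn : (Finset.univ.image ω).card using Nat.strong_induction_on generalizing ω with
  | _ n ih =>
    by_cases hconst : ∃ c, ∀ i, ω i = c
    · obtain ⟨c, hc⟩ := hconst
      exact ⟨0, by simp, by simp, c, by simp [profile, hc]⟩
    have hne : Nonempty α := by
      by_contra h
      exact hconst ⟨0, fun i => absurd ⟨i⟩ h⟩
    obtain ⟨a, ha⟩ := Finite.exists_max ω
    obtain ⟨b, hb, hbmax⟩ := Set.exists_max_image {i | ω i < ω a} ω (Set.toFinite _) (by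
      by_contra h
      refine hconst ⟨ω a, fun i => (ha i).antisymm (not_lt.1 fun hi => h ⟨i, hi⟩)⟩)
    simp only [Set.mem_ofPred_eq] at hb hbmax
    obtain ⟨v, hv⟩ := hω {i | ω i ≤ ω b} (Or.inr ⟨_, rfl⟩)
      (Set.nonempty_iff_ne_empty.1 ⟨b, le_refl (ω b)⟩)
      (Set.nonempty_compl.1 ⟨a, not_le.2 hb⟩)
    have hsub : ∀ A ∈ weightFlag (fun i => min (ω i) (ω b)), A ∈ weightFlag ω := by
      rintro A (rfl | ⟨t, rfl⟩)
      · exact Or.inl rfl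
      rcases le_or_gt (ω b) t with h | h
      · convert univ_mem_weightFlag ω
        exact Set.eq_univ_of_forall fun i => (min_le_right _ _).trans h
      · refine Or.inr ⟨t, Set.ext fun i => ?_⟩
        simp [not_le.2 h]
    have hcard : (Finset.univ.image fun i => min (ω i) (ω b)).card < n := by
      rw [← hn]
      refine Finset.card_lt_card ⟨fun y hy => ?_, fun h => ?_⟩
      · obtain ⟨i, -, rfl⟩ := Finset.mem_image.1 hy
        rcases min_choice (ω i) (ω b) with h | h <;> simp only [h] <;> simp
      · obtain ⟨i, -, hi⟩ := Finset.mem_image.1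
          (h (Finset.mem_image_of_mem ω (Finset.mem_univ a)))
        exact absurd (hi ▸ min_le_right (ω i) (ω b)) (not_le.2 hb)
    obtain ⟨x, hx0, hxs, c, hc⟩ := ih _ hcard _ (fun A hA => hω A (hsub A hA)) rfl
    refine ⟨fun w => x w + if w = v then ω a - ω b else 0, fun w => ?_, fun w hw => ?_, c,
      fun i => ?_⟩
    · refine add_nonneg (hx0 w) ?_
      split_ifs
      · linarith
      · exact le_rfl
    · by_cases hwv : w = v
      · rw [hwv, hv]; exact Or.inr ⟨_, rfl⟩
      · exact hsub _ (hxs w (by simpa [hwv] using hw))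
    · have hprof : profile F (fun w => x w + if w = v then ω a - ω b else 0) i =
          profile F x i + (ω a - ω b) * (F v)ᶜ.indicator 1 i := by
        simp [profile, add_mul, Finset.sum_add_distrib, ite_mul]
      have hci := hc i
      rw [hprof]
      by_cases hi : ω i ≤ ω b
      · have : i ∈ F v := by rw [hv]; exact hi
        rw [min_eq_left hi] at hci
        simp [this, hci]
      · have hiv : i ∉ F v := by rw [hv]; exact hi
        rw [min_eq_right (not_le.1 hi).le] at hci
        have : ω i = ω a := (ha i).antisymm (not_lt.1 fun h => hi (hbmax i h))
        simp only [Set.mem_compl_iff, hiv, not_false_eq_true, Set.indicator_of_mem, Pi.one_apply,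
          mul_one]
        linarith

/-- The weights of a point of the realization determine the point. -/
theorem eq_of_profile_affine [Finite α] {y : V → ℝ} (hF : Function.Injective F)
    (h0 : ∀ v, F v ≠ ∅) (h1 : ∀ v, F v ≠ Set.univ) (hx : ∀ v, 0 ≤ x v)
    (hchain : ∀ v w, x v ≠ 0 → x w ≠ 0 → F v ⊆ F w ∨ F w ⊆ F v) (hy : ∀ v, 0 ≤ y v)
    (hchain' : ∀ v w, y v ≠ 0 → y w ≠ 0 → F v ⊆ F w ∨ F w ⊆ F v) (hxs : ∑ v, x v = 1)
    (hys : ∑ v, y v = 1) {a b : ℝ} (ha : 0 < a)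
    (h : ∀ i, profile F x i = a * (profile F y i - b)) : x = y := by
  have hflag : weightFlag (profile F x) = weightFlag (profile F y) := by
    rw [← weightFlag_affine (profile F y) ha b]
    exact congrArg _ (funext h)
  -- Equal flags give equal supports, and jumps scale by `a`; the normalization of the sums then
  -- forces `a = 1`.
  have key : ∀ v, x v = a * y v := by
    intro v
    have hsupp : x v ≠ 0 ↔ y v ≠ 0 := by
      rw [ne_zero_iff_mem_weightFlag_profile hF h0 h1 hx hchain, hflag,
        ← ne_zero_iff_mem_weightFlag_profile hF h0 h1 hy hchain']
    by_cases hxv : x v = 0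
    · rw [hxv, not_not.1 fun h' => hsupp.2 h' hxv, mul_zero]
    obtain ⟨j, hj, hjmax⟩ := Set.exists_max_image (F v) (profile F y) (Set.toFinite _)
      (Set.nonempty_iff_ne_empty.2 (h0 v))
    obtain ⟨k, hk, hkmin⟩ := Set.exists_min_image (F v)ᶜ (profile F y) (Set.toFinite _)
      (Set.nonempty_compl.2 (h1 v))
    have mono : ∀ i i', profile F y i ≤ profile F y i' → profile F x i ≤ profile F x i' := by
      intro i i' hi
      rw [h, h]
      exact mul_le_mul_of_nonneg_left (sub_le_sub_right hi b) ha.le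
    have e1 := profile_eq_add hF hx hchain hxv hj (fun i hi => mono _ _ (hjmax i hi)) hk
      fun i hi => mono _ _ (hkmin i hi)
    have e2 := profile_eq_add hF hy hchain' (hsupp.1 hxv) hj hjmax hk hkmin
    rw [h, h, e2] at e1
    linarith
  have ha1 : a = 1 := by
    simp only [key, ← Finset.mul_sum, hys, mul_one] at hxs
    exact hxs
  funext v
  rw [key, ha1, one_mul]

end Profile

/-! ### Centered weights and the sphere. -/

section Sphere

variable {n : ℕ} {V : Type*} [Fintype V]

/-- The vector `1_{Aᶜ}`, translated so that its coordinates have sum zero. -/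
noncomputable def vertexPoint (A : Set (Fin n)) : EuclideanSpace ℝ (Fin n) :=
  WithLp.toLp 2 fun i => Aᶜ.indicator 1 i - (∑ j, Aᶜ.indicator 1 j) / n

theorem sum_smul_vertexPoint_apply (F : V → Set (Fin n)) (x : V → ℝ) (i : Fin n) :
    (∑ v, x v • vertexPoint (F v)) i = profile F x i - (∑ j, profile F x j) / n := by
  simp only [WithLp.ofLp_sum, WithLp.ofLp_smul, Finset.sum_apply, Pi.smul_apply, vertexPoint,
    smul_eq_mul, mul_sub, Finset.sum_sub_distrib, profile]
  congr 1
  rw [Finset.sum_comm, Finset.sum_div]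
  refine Finset.sum_congr rfl fun v _ => ?_
  rw [← Finset.mul_sum, mul_div_assoc]

theorem sum_smul_vertexPoint_sum (F : V → Set (Fin n)) (x : V → ℝ) :
    ∑ i, (∑ v, x v • vertexPoint (F v)) i = 0 := by
  simp only [sum_smul_vertexPoint_apply, Finset.sum_sub_distrib, Finset.sum_const,
    Finset.card_univ, Fintype.card_fin, nsmul_eq_mul]
  rcases Nat.eq_zero_or_pos n with rfl | hn
  · simp
  · rw [mul_div_cancel₀ _ (by positivity), sub_self]

theorem mem_bergmanSphere_iff (ω : EuclideanSpace ℝ (Fin n)) :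
    ω ∈ bergmanSphere n ↔ ∑ i, ω i = 0 ∧ ‖ω‖ = 1 := by
  rw [bergmanSphere, Set.mem_ofPred_eq, EuclideanSpace.norm_eq, Real.sqrt_eq_one]
  simp

end Sphere

/-! ### Compactness of the realization. -/

namespace AbstractSimplicialComplex

variable {V : Type*} [Fintype V]

theorem isCompact_realization (K : AbstractSimplicialComplex V) : IsCompact K.realization := by
  have : K.realization = stdSimplex ℝ V ∩ ⋃ s ∈ K.faces, {x | ∀ v, v ∉ s → x v = 0} := by
    ext x
    simp only [realization, Set.mem_ofPred_eq, Set.mem_inter_iff, Set.mem_iUnion, exists_prop]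
    refine and_congr_right fun _ => exists_congr fun s => and_congr_right fun _ => ?_
    exact forall_congr' fun v => not_imp_comm
  rw [this]
  refine (isCompact_stdSimplex ℝ V).inter_right ((Set.toFinite _).isClosed_biUnion fun s _ => ?_)
  simp only [Set.ofPred_forall]
  exact isClosed_iInter fun v => isClosed_iInter fun _ =>
    isClosed_eq (continuous_apply v) continuous_const

end AbstractSimplicialComplex

/-! ### The homeomorphism and its cells. -/

namespace OrientedMatroid

open SignedSet AbstractSimplicialComplex

theorem positiveBergmanComplex_eq_empty {n : ℕ} {M : OrientedMatroid (Fin n)}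
    (hM : ¬ M.IsAcyclic) : M.positiveBergmanComplex = ∅ := by
  refine Set.eq_empty_of_forall_notMem fun ω hω => ?_
  refine hM fun C hC hpos => ?_
  exact (isAcyclic_initialCircuits_iff _).1 hω.2 C hC (isPositive_initial hpos)

variable {n : ℕ} {M : OrientedMatroid (Fin n)}

/-- The positive flat that underlies a vertex of the order complex. -/
abbrev vertexFlat (v : ProperPart M.LasVergnasLattice) : Set (Fin n) := v.1.1

theorem vertexFlat_injective :
    Function.Injective (vertexFlat : ProperPart M.LasVergnasLattice → Set (Fin n)) :=
  fun _ _ h => Subtype.ext (Subtype.ext h)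

theorem vertexFlat_ne_empty (hM : M.IsAcyclic) (v : ProperPart M.LasVergnasLattice) :
    vertexFlat v ≠ ∅ := fun h => v.2.1 ((isBot_lasVergnasLattice_iff hM _).2 h)

theorem vertexFlat_ne_univ (v : ProperPart M.LasVergnasLattice) : vertexFlat v ≠ Set.univ :=
  fun h => v.2.2 ((isTop_lasVergnasLattice_iff _).2 h)

theorem exists_vertexFlat_eq (hM : M.IsAcyclic) {A : Set (Fin n)} (hA : M.IsPositiveFlat A)
    (h0 : A ≠ ∅) (h1 : A ≠ Set.univ) : ∃ v : ProperPart M.LasVergnasLattice, vertexFlat v = A :=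
  ⟨⟨⟨A, hA⟩, fun h => h0 ((isBot_lasVergnasLattice_iff hM _).1 h),
    fun h => h1 ((isTop_lasVergnasLattice_iff _).1 h)⟩, rfl⟩

/-- The realization of the order complex of the proper part of the Las Vergnas face lattice. -/
abbrev lasVergnasRealization (M : OrientedMatroid (Fin n)) :
    Set (ProperPart M.LasVergnasLattice → ℝ) :=
  (orderComplex (ProperPart M.LasVergnasLattice)).realization

/-- The support of `x` can serve as the face; it is nonempty because the coordinates sum to one. -/
theorem mem_lasVergnasRealization_iff {x : ProperPart M.LasVergnasLattice → ℝ} :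
    x ∈ M.lasVergnasRealization ↔ (∀ v, 0 ≤ x v) ∧ ∑ v, x v = 1 ∧
      ∀ v w, x v ≠ 0 → x w ≠ 0 → vertexFlat v ⊆ vertexFlat w ∨ vertexFlat w ⊆ vertexFlat v := by
  classical
  constructor
  · rintro ⟨⟨h0, h1⟩, s, hs, hxs⟩
    refine ⟨h0, h1, fun v w hv hw => ?_⟩
    exact hs.2.total (hxs v hv) (hxs w hw)
  · rintro ⟨h0, h1, hc⟩
    refine ⟨⟨h0, h1⟩, Finset.univ.filter fun v => x v ≠ 0, ⟨?_, fun v hv w hw _ => ?_⟩,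
      by simp⟩
    · by_contra h
      rw [Finset.not_nonempty_iff_eq_empty, Finset.filter_eq_empty_iff] at h
      rw [Finset.sum_eq_zero fun v hv => not_not.1 (h hv)] at h1
      exact zero_ne_one h1
    · simp only [Finset.coe_filter, Finset.mem_univ, true_and, Set.mem_ofPred_eq] at hv hw
      exact hc v w hv hw

/-- The unnormalized placement of a point of the realization. -/
noncomputable def placement (x : ProperPart M.LasVergnasLattice → ℝ) :
    EuclideanSpace ℝ (Fin n) := ∑ v, x v • vertexPoint (vertexFlat v)

/-- A flat with nonzero coefficient is proper and nonempty, so the weights are not constant and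
centering cannot kill them. -/
theorem placement_ne_zero (hM : M.IsAcyclic) {x : ProperPart M.LasVergnasLattice → ℝ}
    (hx : x ∈ M.lasVergnasRealization) : placement x ≠ 0 := by
  obtain ⟨h0, h1, hc⟩ := mem_lasVergnasRealization_iff.1 hx
  obtain ⟨v, -, hv⟩ := Finset.exists_ne_zero_of_sum_ne_zero (h1.trans_ne one_ne_zero)
  obtain ⟨j, hj⟩ := Set.nonempty_iff_ne_empty.2 (vertexFlat_ne_empty hM v)
  obtain ⟨k, hk⟩ := Set.nonempty_compl.2 (vertexFlat_ne_univ v)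
  intro h
  have hjk := profile_lt h0 hc hv hj hk
  have hj' := congrArg (fun u : EuclideanSpace ℝ (Fin n) => u j) h
  have hk' := congrArg (fun u : EuclideanSpace ℝ (Fin n) => u k) h
  simp only [placement, sum_smul_vertexPoint_apply, PiLp.zero_apply] at hj' hk'
  linarith

theorem normalized_placement_apply (x : ProperPart M.LasVergnasLattice → ℝ) (i : Fin n) :
    (‖placement x‖⁻¹ • placement x) i =
      ‖placement x‖⁻¹ * (profile vertexFlat x i - (∑ j, profile vertexFlat x j) / n) := by
  rw [PiLp.smul_apply, placement, sum_smul_vertexPoint_apply, smul_eq_mul]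

theorem weightFlag_placement (hM : M.IsAcyclic) {x : ProperPart M.LasVergnasLattice → ℝ}
    (hx : x ∈ M.lasVergnasRealization) :
    weightFlag (fun i => (‖placement x‖⁻¹ • placement x) i) =
      weightFlag (profile vertexFlat x) := by
  simp only [normalized_placement_apply]
  exact weightFlag_affine _ (inv_pos.2 (norm_pos_iff.2 (placement_ne_zero hM hx))) _

theorem placement_mem (hM : M.IsAcyclic) {x : ProperPart M.LasVergnasLattice → ℝ}
    (hx : x ∈ M.lasVergnasRealization) :
    ‖placement x‖⁻¹ • placement x ∈ M.positiveBergmanComplex := by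
  obtain ⟨h0, h1, hc⟩ := mem_lasVergnasRealization_iff.1 hx
  refine ⟨(mem_bergmanSphere_iff _).2 ⟨?_, ?_⟩, ?_⟩
  · simp only [PiLp.smul_apply, ← Finset.smul_sum]
    rw [placement, sum_smul_vertexPoint_sum, smul_zero]
  · rw [norm_smul, norm_inv, norm_norm,
      inv_mul_cancel₀ (norm_ne_zero_iff.2 (placement_ne_zero hM hx))]
  · rw [isAcyclic_initialCircuits_iff_isPositiveFlat hM, weightFlag_placement hM hx]
    intro A hA
    rcases (mem_weightFlag_profile_iff h0 hc).1 hA with rfl | rfl | ⟨v, -, rfl⟩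
    · exact isPositiveFlat_empty hM
    · exact isPositiveFlat_univ
    · exact v.1.2

/-- The map from the realization to the positive Bergman complex. -/
noncomputable def realizationMap (hM : M.IsAcyclic) (x : M.lasVergnasRealization) :
    M.positiveBergmanComplex := ⟨_, placement_mem hM x.2⟩

theorem continuous_realizationMap (hM : M.IsAcyclic) : Continuous (realizationMap hM) := by
  have h : Continuous fun x : M.lasVergnasRealization => placement x.1 := by
    exact continuous_finsetSum _ fun v _ =>
      ((continuous_apply v).comp continuous_subtype_val).smul continuous_const
  exact ((h.norm.inv₀ fun x => norm_ne_zero_iff.2 (placement_ne_zero hM x.2)).smul h).subtype_mk _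

theorem realizationMap_injective (hM : M.IsAcyclic) : Function.Injective (realizationMap hM) := by
  intro x y hxy
  obtain ⟨hx0, hx1, hxc⟩ := mem_lasVergnasRealization_iff.1 x.2
  obtain ⟨hy0, hy1, hyc⟩ := mem_lasVergnasRealization_iff.1 y.2
  have hx := norm_pos_iff.2 (placement_ne_zero hM x.2)
  have hy := norm_pos_iff.2 (placement_ne_zero hM y.2)
  have hxy' := congrArg Subtype.val hxy
  -- Equal images make the centered profiles proportional, with ratio `a` of the norms; `b` absorbs
  -- the two means.
  refine Subtype.ext (eq_of_profile_affine vertexFlat_injective (vertexFlat_ne_empty hM)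
    vertexFlat_ne_univ hx0 hxc hy0 hyc hx1 hy1 (a := ‖placement x.1‖ * ‖placement y.1‖⁻¹)
    (b := (∑ j, profile vertexFlat y.1 j) / n -
      (∑ j, profile vertexFlat x.1 j) / n / (‖placement x.1‖ * ‖placement y.1‖⁻¹))
    (by positivity) fun i => ?_)
  have hi := congrArg (fun u : EuclideanSpace ℝ (Fin n) => u i) hxy'
  simp only [realizationMap, normalized_placement_apply] at hi
  have hc : ‖placement x.1‖ * ‖placement y.1‖⁻¹ ≠ 0 := by positivity
  rw [inv_mul_eq_iff_eq_mul₀ hx.ne', ← mul_assoc] at hi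
  rw [mul_sub, mul_sub, mul_div_cancel₀ _ hc]
  linarith

theorem realizationMap_surjective (hM : M.IsAcyclic) :
    Function.Surjective (realizationMap hM) := by
  rintro ⟨u, hu⟩
  obtain ⟨hu0, hu1⟩ := (mem_bergmanSphere_iff u).1 hu.1
  have hflat := (isAcyclic_initialCircuits_iff_isPositiveFlat hM _).1 hu.2
  obtain ⟨x, hx0, hxs, c, hc⟩ := exists_profile_eq
    (vertexFlat : ProperPart M.LasVergnasLattice → Set (Fin n)) (fun i => u i)
    fun A hA h0 h1 => exists_vertexFlat_eq hM (hflat A hA) h0 h1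
  -- Since `u` has coordinate sum zero, centering removes exactly the constant `c`.
  have hplace : placement x = u := by
    ext i
    have hn : (n : ℝ) ≠ 0 := Nat.cast_ne_zero.2 (Fin.pos i).ne'
    have hsum : ∑ j, profile vertexFlat x j + n * c = 0 := by
      rw [← hu0]
      simp [hc, Finset.sum_add_distrib]
    rw [placement, sum_smul_vertexPoint_apply, hc i, eq_neg_of_add_eq_zero_left hsum]
    field_simp
    ring
  have hS : 0 < ∑ v, x v := by
    refine lt_of_le_of_ne (Finset.sum_nonneg fun v _ => hx0 v) fun h => ?_
    have hx : x = 0 := funext fun v =>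
      (Finset.sum_eq_zero_iff_of_nonneg fun v _ => hx0 v).1 h.symm v (Finset.mem_univ v)
    rw [← hplace, hx] at hu1
    simp [placement] at hu1
  have hy : (∑ v, x v)⁻¹ • x ∈ M.lasVergnasRealization := by
    refine mem_lasVergnasRealization_iff.2 ⟨fun v => mul_nonneg (inv_pos.2 hS).le (hx0 v), ?_,
      fun v w hv hw => ?_⟩
    · simp only [Pi.smul_apply, smul_eq_mul, ← Finset.mul_sum]
      exact inv_mul_cancel₀ hS.ne'
    · exact weightFlag_chain (hxs v (right_ne_zero_of_mul hv)) (hxs w (right_ne_zero_of_mul hw))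
  refine ⟨⟨_, hy⟩, Subtype.ext ?_⟩
  have hpl : placement ((∑ v, x v)⁻¹ • x) = (∑ v, x v)⁻¹ • u := by
    rw [← hplace, placement, placement, Finset.smul_sum]
    simp only [Pi.smul_apply, smul_assoc]
  simp only [realizationMap, hpl, norm_smul, hu1, norm_inv, Real.norm_of_nonneg hS.le, mul_one,
    inv_inv]
  rw [smul_smul, mul_inv_cancel₀ hS.ne', one_smul]

/-- The homeomorphism from the realization to the positive Bergman complex. -/
noncomputable def realizationHomeomorph (hM : M.IsAcyclic) :
    M.lasVergnasRealization ≃ₜ M.positiveBergmanComplex :=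
  haveI : CompactSpace M.lasVergnasRealization :=
    isCompact_iff_compactSpace.1 (isCompact_realization _)
  (continuous_realizationMap hM).homeoOfEquivCompactToT2
    (f := Equiv.ofBijective _ ⟨realizationMap_injective hM, realizationMap_surjective hM⟩)

theorem weightFlag_realizationHomeomorph_eq_iff (hM : M.IsAcyclic)
    (x y : M.lasVergnasRealization) :
    weightFlag (fun i => (realizationHomeomorph hM x : EuclideanSpace ℝ (Fin n)) i) =
      weightFlag (fun i => (realizationHomeomorph hM y : EuclideanSpace ℝ (Fin n)) i) ↔
    ∀ v, x.1 v ≠ 0 ↔ y.1 v ≠ 0 := by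
  obtain ⟨hx0, -, hxc⟩ := mem_lasVergnasRealization_iff.1 x.2
  obtain ⟨hy0, -, hyc⟩ := mem_lasVergnasRealization_iff.1 y.2
  refine Iff.trans (Eq.congr (weightFlag_placement hM x.2) (weightFlag_placement hM y.2)) ?_
  constructor
  · intro h v
    rw [ne_zero_iff_mem_weightFlag_profile vertexFlat_injective (vertexFlat_ne_empty hM)
      vertexFlat_ne_univ hx0 hxc, h, ← ne_zero_iff_mem_weightFlag_profile vertexFlat_injective
      (vertexFlat_ne_empty hM) vertexFlat_ne_univ hy0 hyc]
  · intro h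
    ext A
    simp only [mem_weightFlag_profile_iff hx0 hxc, mem_weightFlag_profile_iff hy0 hyc, h]

/-- The barycenter of the face; cells are classes of actual points, so every open simplex has to be
nonempty. -/
theorem exists_mem_openSimplex {s : Finset (ProperPart M.LasVergnasLattice)}
    (hs : s ∈ (orderComplex (ProperPart M.LasVergnasLattice)).faces) :
    ∃ x : M.lasVergnasRealization,
      x ∈ (orderComplex (ProperPart M.LasVergnasLattice)).openSimplex s := by
  classical
  have hcard : (s.card : ℝ) ≠ 0 := Nat.cast_ne_zero.2 (Finset.card_pos.2 hs.1).ne'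
  refine ⟨⟨fun v => if v ∈ s then (s.card : ℝ)⁻¹ else 0, ⟨⟨fun v => ?_, ?_⟩, s, hs, ?_⟩⟩, ?_⟩
  · dsimp only
    split_ifs <;> positivity
  · simp [hcard]
  · intro v hv
    by_contra h
    simp [h] at hv
  · intro v
    simp [hcard]

theorem fineSubdivision_eq (hM : M.IsAcyclic) :
    M.fineSubdivision = {cell | ∃ s ∈ (orderComplex (ProperPart M.LasVergnasLattice)).faces,
      cell = (fun x => (realizationHomeomorph hM x : EuclideanSpace ℝ (Fin n))) ''
        (orderComplex (ProperPart M.LasVergnasLattice)).openSimplex s} := by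
  classical
  have hcell : ∀ (s : Finset (ProperPart M.LasVergnasLattice)) (x : M.lasVergnasRealization),
      x ∈ (orderComplex (ProperPart M.LasVergnasLattice)).openSimplex s →
      {v ∈ M.positiveBergmanComplex | weightFlag (fun i => v i) =
        weightFlag (fun i => (realizationHomeomorph hM x : EuclideanSpace ℝ (Fin n)) i)} =
      (fun x => (realizationHomeomorph hM x : EuclideanSpace ℝ (Fin n))) ''
        (orderComplex (ProperPart M.LasVergnasLattice)).openSimplex s := by
    intro s x hx
    ext u
    constructor
    · rintro ⟨hu, hflag⟩
      obtain ⟨y, hy⟩ := (realizationHomeomorph hM).surjective ⟨u, hu⟩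
      have hyu : (realizationHomeomorph hM y : EuclideanSpace ℝ (Fin n)) = u := by rw [hy]
      rw [← hyu, weightFlag_realizationHomeomorph_eq_iff] at hflag
      exact ⟨y, fun v => (hflag v).trans (hx v), hyu⟩
    · rintro ⟨y, hy, rfl⟩
      refine ⟨(realizationHomeomorph hM y).2, ?_⟩
      rw [weightFlag_realizationHomeomorph_eq_iff]
      exact fun v => (hy v).trans (hx v).symm
  ext cell
  constructor
  · rintro ⟨u, hu, rfl⟩
    obtain ⟨x, hx⟩ := (realizationHomeomorph hM).surjective ⟨u, hu⟩
    have hxu : (realizationHomeomorph hM x : EuclideanSpace ℝ (Fin n)) = u := by rw [hx]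
    obtain ⟨t, ht, hxt⟩ := x.2.2
    have hs : Finset.univ.filter (fun v => x.1 v ≠ 0) ∈
        (orderComplex (ProperPart M.LasVergnasLattice)).faces := by
      refine ⟨?_, ht.2.mono fun v hv => hxt v (Finset.mem_filter.1 hv).2⟩
      obtain ⟨v, -, hv⟩ := Finset.exists_ne_zero_of_sum_ne_zero (x.2.1.2.trans_ne one_ne_zero)
      exact ⟨v, by simpa using hv⟩
    exact ⟨_, hs, hxu ▸ hcell _ x fun v => by simp⟩
  · rintro ⟨s, hs, rfl⟩
    obtain ⟨x, hx⟩ := exists_mem_openSimplex hs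
    exact ⟨_, (realizationHomeomorph hM x).2, (hcell s x hx).symm⟩

end OrientedMatroid

theorem mainTheorem2 {n : ℕ} (M : OrientedMatroid (Fin n)) :
    (M.IsAcyclic →
      (orderComplex (ProperPart M.LasVergnasLattice)).IsSphericalRealization
        M.positiveBergmanComplex M.fineSubdivision) ∧
    (¬ M.IsAcyclic → M.positiveBergmanComplex = ∅) := by
  refine ⟨fun hM => ⟨fun ω hω => ?_, fun v => vertexPoint v.1.1,
    OrientedMatroid.realizationHomeomorph hM, fun x => rfl, OrientedMatroid.fineSubdivision_eq hM⟩,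
    OrientedMatroid.positiveBergmanComplex_eq_empty⟩
  simpa using ((mem_bergmanSphere_iff ω).1 hω.1).2
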